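/- Conventions. A TDLC-group is a locally compact topological group that is totally disconnected (hence Hausdorff). A locally compact group is compactly generated if it is generated, as an abstract group, by a compact subset; it is compactly presented if it has a presentation $\langle K\mid R\rangle$ in which $K$ is a compact subset of the group and the lengths of the relators in $R$, as words in $K^{\pm1}$, are uniformly bounded. A Cayley–Abels graph of a TDLC-group $G$ is a locally finite connected simple graph on which $G$ acts by automorphisms, transitively on the vertices and with compact open vertex stabilizers. A connected graph with its edge-path metric is hyperbolic if there is a constant $\delta$ such that all its geodesic triangles are $\delta$-slim. A TDLC-group is hyperbolic if it is compactly generated and some (equivalently, any) Cayley–Abels graph of it is hyperbolic. A left $\mathbb{Q}[G]$-module is discrete if the stabilizer in $G$ of each of its elements is open. The rational discrete cohomological dimension $\mathrm{cd}_{\mathbb{Q}}(G)\in\mathbb{N}\cup\{\infty\}$ is the least $n$ such that the trivial module $\mathbb{Q}$ has a resolution $0\to P_n\to\cdots\to P_0\to\mathbb{Q}\to 0$ by projective objects of the category of discrete $\mathbb{Q}[G]$-modules, and $\infty$ if there is no such $n$. Theorem. Let $G$ be a hyperbolic TDLC-group with $\mathrm{cd}_{\mathbb{Q}}(G)\leq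 2$. Then every closed subgroup $H$ of $G$ that is compactly presented (in the subspace topology) is hyperbolic. -/

import Mathlib

universe u v

namespace TDLC

/-- A simple graph is (Gromov) hyperbolic if it is connected and there is a constant `δ` such that
every geodesic triangle is `δ`-slim: every vertex of one side is at edge-path distance at most `δ`
from some vertex of the union of the other two sides. (Only one side has to be mentioned, as the
condition is required for all triangles.) -/
def IsHyperbolicGraph {V : Type v} (Γ : SimpleGraph V) : Prop :=
  Γ.Connected ∧ ∃ δ : ℕ, ∀ (x y z : V) (p : Γ.Walk x y) (q : Γ.Walk y z) (r : Γ.Walk x z),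
    p.length = Γ.dist x y → q.length = Γ.dist y z → r.length = Γ.dist x z →
      ∀ a ∈ p.support, ∃ b, (b ∈ q.support ∨ b ∈ r.support) ∧ Γ.dist a b ≤ δ

section Geometry

variable (G : Type u) [Group G] [TopologicalSpace G]

/-- `G` is generated, as an abstract group, by a compact subset. -/
def IsCompactlyGenerated : Prop :=
  ∃ K : Set G, IsCompact K ∧ Subgroup.closure K = ⊤

open Classical in
/-- `G` has a presentation `⟨K | R⟩` with `K` a compact subset of `G` and relators of uniformly
bounded word length: the canonical homomorphism from the free group on `K` to `G` is onto, and its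
kernel is the normal closure of `R`. -/
def IsCompactlyPresented : Prop :=
  ∃ (K : Set G) (R : Set (FreeGroup K)) (n : ℕ),
    IsCompact K ∧ (∀ r ∈ R, r.norm ≤ n) ∧
    Function.Surjective (FreeGroup.lift (Subtype.val : K → G)) ∧
    Subgroup.normalClosure R = (FreeGroup.lift (Subtype.val : K → G)).ker

/-- A Cayley–Abels graph of `G`: a locally finite connected graph on which `G` acts by
automorphisms, transitively on vertices, with compact open vertex stabilizers. -/
structure IsCayleyAbelsGraph {V : Type v} [MulAction G V] (Γ : SimpleGraph V) : Prop where
  connected : Γ.Connected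
  locally_finite : ∀ x : V, (Γ.neighborSet x).Finite
  adj_smul_iff : ∀ (g : G) (x y : V), Γ.Adj (g • x) (g • y) ↔ Γ.Adj x y
  transitive : ∀ x y : V, ∃ g : G, g • x = y
  isCompact_stabilizer : ∀ x : V, IsCompact (MulAction.stabilizer G x : Set G)
  isOpen_stabilizer : ∀ x : V, IsOpen (MulAction.stabilizer G x : Set G)

/-- `G` is hyperbolic: it is compactly generated and some Cayley–Abels graph of `G` is hyperbolic.
The vertex set of a Cayley–Abels graph is a coset space of `G`, so that it is no restriction
to take it in the universe of `G`. -/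
def IsHyperbolic : Prop :=
  IsCompactlyGenerated G ∧
    ∃ (V : Type u) (_ : MulAction G V) (Γ : SimpleGraph V),
      IsCayleyAbelsGraph G Γ ∧ IsHyperbolicGraph Γ

end Geometry

section Cohomology

variable (G : Type u) [Group G] [TopologicalSpace G]

/-- A `ℚ[G]`-module is discrete if the stabilizer of each of its elements is open in `G`. -/
def IsDiscreteModule (M : Type v) [AddCommGroup M] [Module (MonoidAlgebra ℚ G) M] : Prop :=
  ∀ m : M, IsOpen {g : G | MonoidAlgebra.of ℚ G g • m = m}

/-- `P` is a projective object of the abelian category of discrete `ℚ[G]`-modules. (Submodules and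
quotients of discrete modules are discrete, so that the epimorphisms are the surjections.) -/
def IsProjectiveDiscreteModule (P : Type u) [AddCommGroup P] [Module (MonoidAlgebra ℚ G) P] :
    Prop :=
  IsDiscreteModule G P ∧
    ∀ (M N : Type u) [AddCommGroup M] [AddCommGroup N]
      [Module (MonoidAlgebra ℚ G) M] [Module (MonoidAlgebra ℚ G) N],
      IsDiscreteModule G M → IsDiscreteModule G N →
      ∀ (π : M →ₗ[MonoidAlgebra ℚ G] N) (f : P →ₗ[MonoidAlgebra ℚ G] N),
        Function.Surjective π → ∃ h : P →ₗ[MonoidAlgebra ℚ G] M, π ∘ₗ h = f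

/-- `ℚ` as the trivial `ℚ[G]`-module. -/
abbrev TrivialModule : Type := (Representation.trivial ℚ G ℚ).asModule

/-- The trivial module `ℚ` has a resolution
`0 → P n → ⋯ → P 1 → P 0 → ℚ → 0` by projective objects of the category of discrete
`ℚ[G]`-modules; it is written as an infinite resolution whose terms vanish above degree `n`. -/
def HasProjectiveResolutionOfLength (n : ℕ) : Prop :=
  ∃ (P : ℕ → Type u) (_ : ∀ i, AddCommGroup (P i)) (_ : ∀ i, Module (MonoidAlgebra ℚ G) (P i))
    (d : ∀ i, P (i + 1) →ₗ[MonoidAlgebra ℚ G] P i)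
    (ε : P 0 →ₗ[MonoidAlgebra ℚ G] TrivialModule G),
    (∀ i, IsProjectiveDiscreteModule G (P i)) ∧
    (∀ i, n < i → Subsingleton (P i)) ∧
    Function.Surjective ε ∧ Function.Exact (d 0) ε ∧
    ∀ i, Function.Exact (d (i + 1)) (d i)

/-- The rational discrete cohomological dimension `cd_ℚ(G)`: the least `n` such that the trivial
module has a projective resolution of length `n` by discrete `ℚ[G]`-modules,
and `⊤` if there is none. -/
noncomputable def rationalCohomologicalDimension : ℕ∞ :=
  sInf {m : ℕ∞ | ∃ n : ℕ, m = n ∧ HasProjectiveResolutionOfLength G n}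

end Cohomology

end TDLC

-- Let `V` be the vertex set of a hyperbolic Cayley–Abels graph of `G`. The full simplex on `V` is
-- acyclic, and its rational chain modules are permutation modules with compact open stabilizers.
-- Over `ℚ` one may average over compact stabilizers, so these modules are projective among discrete
-- modules. Comparison with a projective resolution of length at most two then splits the boundary
-- from 2-chains onto 1-cycles `G`-equivariantly (`exists_equivariant_filling`). This section `s`
-- gives a `G`-invariant size `l1 (s z)` of a cycle. It is bounded on triangles of bounded diameter,
-- hence, by cutting shortcuts off closed walks in a hyperbolic graph, at most linear in the length
-- of a closed walk (`IsFillingNorm.exists_linear_bound`).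
--
-- For `H`, fix a word length `m` that accommodates the relators and the stabilizer of a vertex `v`,
-- and consider pairs and triples of points of `H • v` that are related within word length `m`.
-- Compact presentation makes every 1-cycle of this complex a boundary (`mem_relBoundaries`).
-- Averaging over `H` gives an equivariant retraction `r` of all 1-cycles of the simplex onto those
-- of this complex. Since `H` has finitely many orbits of related triples, `s` of a related cycle is
-- supported on finitely many `H`-orbits of triples of `V`. Expanding `z = r (bd2 (s z))` therefore
-- bounds the filling size of `z` inside the complex by a multiple of `l1 (s z)`
-- (`exists_bound_by_filling`). The finite-dimensionality of `G` thus transfers the linear bound to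
-- `H`, although distances in `H • v` may be badly distorted in `V`.
--
-- Finally, a linear homological isoperimetric inequality forces hyperbolicity
-- (`HasLinearFilling.isHyperbolicGraph`). In a fat triangle, a path avoiding a ball of radius `D`
-- about a point of a geodesic would have length linear in `D`. Testing against a cut-off of the
-- differential of the distance function shows that it must be quadratic. The inequality is used in
-- dual form, through functionals, so no filling norm on the complex of `H` is ever defined.

universe w

namespace TDLC

open Finsupp
open scoped Pointwise

/-! ### The `ℓ¹`-norm on rational chains. -/

section Norm

variable {X : Type*}

/-- The `ℓ¹`-norm of a finitely supported rational chain. -/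
def l1 (x : X →₀ ℚ) : ℚ := x.sum fun _ a => |a|

theorem l1_eq_sum_of_subset (x : X →₀ ℚ) {s : Finset X} (hs : x.support ⊆ s) :
    l1 x = ∑ i ∈ s, |x i| :=
  Finsupp.sum_of_support_subset x hs _ (by simp)

@[simp] theorem l1_zero : l1 (0 : X →₀ ℚ) = 0 := by simp [l1]

theorem l1_add_le (x y : X →₀ ℚ) : l1 (x + y) ≤ l1 x + l1 y := by
  classical
  rw [l1_eq_sum_of_subset (x + y) Finsupp.support_add,
    l1_eq_sum_of_subset x Finset.subset_union_left,
    l1_eq_sum_of_subset y Finset.subset_union_right, ← Finset.sum_add_distrib]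
  exact Finset.sum_le_sum fun i _ => by simpa using abs_add_le (x i) (y i)

@[simp] theorem l1_neg (x : X →₀ ℚ) : l1 (-x) = l1 x := by
  simp [l1, Finsupp.sum, Finsupp.support_neg]

theorem l1_mapDomain {Y : Type*} {f : X → Y} (hf : Function.Injective f) (x : X →₀ ℚ) :
    l1 (x.mapDomain f) = l1 x :=
  Finsupp.sum_mapDomain_index_inj hf

theorem abs_apply_le_mul_l1 (L : (X →₀ ℚ) →ₗ[ℚ] ℚ) (x : X →₀ ℚ) (M : ℚ)
    (h : ∀ i ∈ x.support, |L (single i 1)| ≤ M) : |L x| ≤ M * l1 x := by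
  have hx : L x = ∑ i ∈ x.support, x i * L (single i 1) := by
    conv_lhs => rw [← Finsupp.sum_single x, Finsupp.sum, map_sum]
    refine Finset.sum_congr rfl fun i _ => ?_
    rw [← smul_eq_mul, ← map_smul, Finsupp.smul_single_one]
  rw [hx, l1, Finsupp.sum, Finset.mul_sum]
  refine (Finset.abs_sum_le_sum_abs _ _).trans (Finset.sum_le_sum fun i hi => ?_)
  rw [abs_mul, mul_comm]
  exact mul_le_mul_of_nonneg_right (h i hi) (abs_nonneg _)

end Norm

/-! ### Chains of the full simplex. -/

section Chains

variable (V : Type*)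

/-- The boundary of the full simplex on `V` in degree one. -/
noncomputable def bd1 : (V × V →₀ ℚ) →ₗ[ℚ] (V →₀ ℚ) :=
  linearCombination ℚ fun e => single e.2 1 - single e.1 1

/-- The boundary of the full simplex on `V` in degree two. -/
noncomputable def bd2 : (V × V × V →₀ ℚ) →ₗ[ℚ] (V × V →₀ ℚ) :=
  linearCombination ℚ fun t => single (t.2.1, t.2.2) 1 - single (t.1, t.2.2) 1 +
    single (t.1, t.2.1) 1

/-- The augmentation. -/
noncomputable def aug : (V →₀ ℚ) →ₗ[ℚ] ℚ := linearCombination ℚ fun _ => 1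

variable {V}

@[simp] theorem bd1_single (a b : V) : bd1 V (single (a, b) 1) = single b 1 - single a 1 := by
  simp [bd1]

@[simp] theorem bd2_single (a b c : V) :
    bd2 V (single (a, b, c) 1) = single (b, c) 1 - single (a, c) 1 + single (a, b) 1 := by
  simp [bd2]

@[simp] theorem aug_single (a : V) : aug V (single a 1) = 1 := by simp [aug]

theorem aug_bd1 (x : V × V →₀ ℚ) : aug V (bd1 V x) = 0 := by
  have : aug V ∘ₗ bd1 V = 0 := by
    ext ⟨a, b⟩; simp
  exact congr($this x)

theorem bd1_bd2 (x : V × V × V →₀ ℚ) : bd1 V (bd2 V x) = 0 := by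
  have : bd1 V ∘ₗ bd2 V = 0 := by
    ext1 ⟨a, b, c⟩; ext1; simp
  exact congr($this x)

/-- The cone with apex `o` on a `0`-chain. -/
noncomputable def cone0 (o : V) : (V →₀ ℚ) →ₗ[ℚ] (V × V →₀ ℚ) :=
  linearCombination ℚ fun a => single (o, a) 1

/-- The cone with apex `o` on a `1`-chain. -/
noncomputable def cone1 (o : V) : (V × V →₀ ℚ) →ₗ[ℚ] (V × V × V →₀ ℚ) :=
  linearCombination ℚ fun e => single (o, e.1, e.2) 1

@[simp] theorem cone0_single (o a : V) : cone0 o (single a 1) = single (o, a) 1 := by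
  simp [cone0]

@[simp] theorem cone1_single (o a b : V) :
    cone1 o (single (a, b) 1) = single (o, a, b) 1 := by
  simp [cone1]

theorem bd1_cone0 (o : V) (x : V →₀ ℚ) : bd1 V (cone0 o x) = x - aug V x • single o 1 := by
  have : bd1 V ∘ₗ cone0 o = LinearMap.id - (aug V).smulRight (single o 1) := by
    ext1 a; ext1; simp
  simpa using congr($this x)

/-- The contracting homotopy. It gives acyclicity of the simplex, and it also compares a walk with
the edge joining its ends. -/
theorem bd2_cone1 (o : V) (x : V × V →₀ ℚ) :
    bd2 V (cone1 o x) = x - cone0 o (bd1 V x) := by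
  have : bd2 V ∘ₗ cone1 o = LinearMap.id - cone0 o ∘ₗ bd1 V := by
    ext1 ⟨a, b⟩; ext1; simp; abel
  simpa using congr($this x)

end Chains

section Action

variable (G : Type*) [Group G] (X : Type*) [MulAction G X]

/-- The rational permutation representation on finitely supported chains. -/
noncomputable def permRep : Representation ℚ G (X →₀ ℚ) where
  toFun g := lmapDomain ℚ ℚ (g • ·)
  map_one' := by ext1; ext1; simp
  map_mul' g h := by ext1; ext1; simp [mul_smul]

variable {G X}

@[simp] theorem permRep_single (g : G) (x : X) (a : ℚ) :
    permRep G X g (single x a) = single (g • x) a := by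
  simp [permRep]

@[simp] theorem l1_permRep (g : G) (x : X →₀ ℚ) : l1 (permRep G X g x) = l1 x :=
  l1_mapDomain (MulAction.injective g) x

theorem mem_support_permRep {g : G} {x : X →₀ ℚ} {i : X}
    (h : i ∈ (permRep G X g x).support) : ∃ j ∈ x.support, g • j = i := by
  classical
  simpa using Finsupp.mapDomain_support h

theorem bd1_permRep (g : G) (x : X × X →₀ ℚ) :
    bd1 X (permRep G (X × X) g x) = permRep G X g (bd1 X x) := by
  have : bd1 X ∘ₗ permRep G (X × X) g = permRep G X g ∘ₗ bd1 X := by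
    ext1 ⟨a, b⟩; ext1; simp
  exact congr($this x)

theorem bd2_permRep (g : G) (x : X × X × X →₀ ℚ) :
    bd2 X (permRep G (X × X × X) g x) = permRep G (X × X) g (bd2 X x) := by
  have : bd2 X ∘ₗ permRep G (X × X × X) g = permRep G (X × X) g ∘ₗ bd2 X := by
    ext1 ⟨a, b, c⟩; ext1; simp
  exact congr($this x)

theorem aug_permRep (g : G) (x : X →₀ ℚ) : aug X (permRep G X g x) = aug X x := by
  have : aug X ∘ₗ permRep G X g = aug X := by
    ext1 a; ext1; simp
  exact congr($this x)

end Action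

section WalkChain

variable {V : Type*} {Γ : SimpleGraph V}

/-- The `1`-chain of a walk. -/
noncomputable def walkChain : ∀ {a b : V}, Γ.Walk a b → (V × V →₀ ℚ)
  | _, _, .nil => 0
  | a, _, .cons (v := c) _ p => single (a, c) 1 + walkChain p

@[simp] theorem walkChain_nil (a : V) : walkChain (.nil : Γ.Walk a a) = 0 := rfl

@[simp] theorem walkChain_cons {a b c : V} (h : Γ.Adj a b) (p : Γ.Walk b c) :
    walkChain (.cons h p) = single (a, b) 1 + walkChain p := rfl

theorem walkChain_append {a b c : V} (p : Γ.Walk a b) (q : Γ.Walk b c) :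
    walkChain (p.append q) = walkChain p + walkChain q := by
  induction p with
  | nil => simp
  | cons h p ih => simp [ih, add_assoc]

theorem bd1_walkChain {a b : V} (p : Γ.Walk a b) :
    bd1 V (walkChain p) = single b 1 - single a 1 := by
  induction p with
  | nil => simp
  | cons h p ih => simp [ih]

theorem bd1_walkChain_closed {a : V} (p : Γ.Walk a a) : bd1 V (walkChain p) = 0 := by
  simp [bd1_walkChain]

theorem mem_support_walkChain {a b : V} (p : Γ.Walk a b) {e : V × V}
    (he : e ∈ (walkChain p).support) : Γ.Adj e.1 e.2 := by
  classical
  induction p with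
  | nil => simp at he
  | cons h p ih =>
    rcases Finset.mem_union.1 (Finsupp.support_add he) with h' | h'
    · have := Finsupp.support_single_subset h'
      simp only [Finset.mem_singleton] at this
      rw [this]; exact h
    · exact ih h'

end WalkChain

theorem finite_image_of_isLocallyConstant {X Y : Type*} [TopologicalSpace X] {f : X → Y}
    (hf : IsLocallyConstant f) {S : Set X} (hS : IsCompact S) : (f '' S).Finite := by
  let _ : TopologicalSpace Y := ⊥
  have : DiscreteTopology Y := ⟨rfl⟩
  exact (hS.image hf.continuous).finite_of_discrete

/-! ### Averaging and equivariant choices. -/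

section Selection

variable {G : Type*} [Group G] [TopologicalSpace G] [IsTopologicalGroup G]
  {E : Type*} [AddCommGroup E] [Module ℚ E] (ρ : Representation ℚ G E)

theorem isLocallyConstant_rep {e : E} (he : IsOpen {g : G | ρ g e = e}) :
    IsLocallyConstant fun g => ρ g e := by
  rw [IsLocallyConstant.iff_exists_open]
  intro g
  refine ⟨(fun h => g⁻¹ * h) ⁻¹' {g : G | ρ g e = e}, he.preimage (continuous_const_mul _),
    by simp, fun h hh => ?_⟩
  have : ρ (g⁻¹ * h) e = e := hh
  calc ρ h e = ρ (g * (g⁻¹ * h)) e := by simp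
    _ = ρ g e := by rw [map_mul, Module.End.mul_apply, this]

/-- A compact group acting discretely has finite orbits. The barycentre of an orbit in `T` is fixed
and, by convexity, stays in `T`. -/
theorem exists_fixed_of_convex (hρ : ∀ e, IsOpen {g : G | ρ g e = e}) (S : Subgroup G)
    (hS : IsCompact (S : Set G)) {T : Set E} (hconv : Convex ℚ T) (hne : T.Nonempty)
    (hT : ∀ g ∈ S, ∀ e ∈ T, ρ g e ∈ T) : ∃ e ∈ T, ∀ g ∈ S, ρ g e = e := by
  classical
  obtain ⟨e₀, he₀⟩ := hne
  have hfin := finite_image_of_isLocallyConstant (isLocallyConstant_rep ρ (hρ e₀)) hS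
  set O : Finset E := hfin.toFinset with hO
  have hmem : ∀ o, o ∈ O ↔ ∃ g ∈ S, ρ g e₀ = o := fun o => by simp [hO]
  have hOne : (O.card : ℚ) ≠ 0 := by
    have : e₀ ∈ O := (hmem _).2 ⟨1, S.one_mem, by simp⟩
    exact_mod_cast Finset.card_ne_zero_of_mem this
  refine ⟨∑ o ∈ O, (O.card : ℚ)⁻¹ • o, hconv.sum_mem (fun _ _ => by positivity)
    (by simp [hOne]) ?_, fun g hg => ?_⟩
  · intro o ho
    obtain ⟨g, hg, rfl⟩ := (hmem o).1 ho
    exact hT g hg _ he₀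
  · rw [map_sum]
    have key : ∀ g ∈ S, ∀ o ∈ O, ρ g o ∈ O := by
      intro g hg o ho
      obtain ⟨h, hh, rfl⟩ := (hmem o).1 ho
      exact (hmem _).2 ⟨g * h, S.mul_mem hg hh, by simp⟩
    refine Finset.sum_bij' (fun o _ => ρ g o) (fun o _ => ρ g⁻¹ o) (key g hg)
      (key g⁻¹ (S.inv_mem hg)) ?_ ?_ ?_
    · intro o _; simp
    · intro o _; simp
    · intro o _; simp

/-- An equivariant family of nonempty convex subsets of a discrete rational representation has an
equivariant selection, if the index set has compact stabilizers. -/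
theorem exists_equivariant_selection {X : Type*} [MulAction G X]
    (hX : ∀ x : X, IsCompact (MulAction.stabilizer G x : Set G))
    (hρ : ∀ e, IsOpen {g : G | ρ g e = e}) (T : X → Set E) (hconv : ∀ x, Convex ℚ (T x))
    (hne : ∀ x, (T x).Nonempty) (hT : ∀ g x, ∀ e ∈ T x, ρ g e ∈ T (g • x)) :
    ∃ f : X → E, (∀ x, f x ∈ T x) ∧ ∀ g x, f (g • x) = ρ g (f x) := by
  have h1 : ∀ x, ∃ e ∈ T x, ∀ g ∈ MulAction.stabilizer G x, ρ g e = e := fun x =>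
    exists_fixed_of_convex ρ hρ _ (hX x) (hconv x) (hne x) fun g hg e he => by
      simpa [MulAction.mem_stabilizer_iff.1 hg] using hT g x e he
  choose c hc hcfix using h1
  let rep : X → X := fun x => (Quotient.mk (MulAction.orbitRel G X) x).out
  have hrep : ∀ x, ∃ g : G, g • rep x = x := fun x => by
    have : (MulAction.orbitRel G X) (rep x) x := Quotient.mk_out (s := MulAction.orbitRel G X) x
    exact (MulAction.orbitRel G X).symm this
  choose γ hγ using hrep
  have hrep' : ∀ (g : G) x, rep (g • x) = rep x := fun g x => by
    have : Quotient.mk (MulAction.orbitRel G X) (g • x) = Quotient.mk (MulAction.orbitRel G X) x :=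
      Quotient.sound ⟨g, rfl⟩
    simp only [rep, this]
  refine ⟨fun x => ρ (γ x) (c (rep x)), fun x => ?_, fun g x => ?_⟩
  · simpa [hγ] using hT (γ x) _ _ (hc (rep x))
  · have h2 : (g * γ x)⁻¹ * γ (g • x) ∈ MulAction.stabilizer G (rep x) := by
      have h3 := hγ (g • x)
      rw [hrep'] at h3
      rw [MulAction.mem_stabilizer_iff, mul_smul, h3, inv_smul_eq_iff, mul_smul, hγ]
    have h4 := hcfix (rep x) _ h2
    simp only [hrep']
    calc ρ (γ (g • x)) (c (rep x)) = ρ ((g * γ x) * ((g * γ x)⁻¹ * γ (g • x))) (c (rep x)) := by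
          simp
      _ = _ := by rw [map_mul, Module.End.mul_apply, h4]; simp

end Selection

section Permutation

variable {G : Type*} [Group G] [TopologicalSpace G] [IsTopologicalGroup G]
  {X : Type*} [MulAction G X]

theorem isOpen_fixing_permRep (hX : ∀ x : X, IsOpen (MulAction.stabilizer G x : Set G))
    (e : X →₀ ℚ) : IsOpen {g : G | permRep G X g e = e} := by
  let S : Subgroup G :=
    { carrier := {g : G | permRep G X g e = e}
      mul_mem' := fun {a b} ha hb => by
        simp only [Set.mem_ofPred_eq, map_mul, Module.End.mul_apply] at *
        rw [hb, ha]
      one_mem' := by simp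
      inv_mem' := fun {a} ha => by
        simp only [Set.mem_ofPred_eq] at *
        conv_lhs => rw [← ha]
        simp }
  have hO : IsOpen (⋂ x ∈ e.support, (MulAction.stabilizer G x : Set G)) :=
    isOpen_biInter_finset fun x _ => hX x
  refine Subgroup.isOpen_mono (H₁ := ⨅ x ∈ e.support, MulAction.stabilizer G x) (H₂ := S) ?_ ?_
  · intro g hg
    simp only [Subgroup.mem_iInf, MulAction.mem_stabilizer_iff] at hg
    change permRep G X g e = e
    conv_lhs => rw [← Finsupp.sum_single e]
    conv_rhs => rw [← Finsupp.sum_single e]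
    simp only [Finsupp.sum, map_sum, permRep_single]
    exact Finset.sum_congr rfl fun x hx => by rw [hg x hx]
  · simpa [Subgroup.coe_iInf] using hO

end Permutation

section AsModule

variable {G : Type*} [Group G]

/-- The linear map of modules over the group algebra induced by an intertwining linear map. -/
noncomputable def asModuleMap {E F : Type*} [AddCommGroup E] [Module ℚ E] [AddCommGroup F]
    [Module ℚ F] {ρ : Representation ℚ G E} {σ : Representation ℚ G F} (L : E →ₗ[ℚ] F)
    (h : ∀ g x, L (ρ g x) = σ g (L x)) : ρ.asModule →ₗ[MonoidAlgebra ℚ G] σ.asModule :=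
  MonoidAlgebra.equivariantOfLinearOfComm
    (V := ρ.asModule) (W := σ.asModule) (σ.asModuleEquiv.symm.toLinearMap ∘ₗ L ∘ₗ
      ρ.asModuleEquiv.toLinearMap) fun g v => by
        simp only [Representation.single_smul, one_smul]
        exact h g v

theorem of_smul_asModule {E : Type*} [AddCommGroup E] [Module ℚ E] (ρ : Representation ℚ G E)
    (g : G) (x : ρ.asModule) : MonoidAlgebra.of ℚ G g • x = ρ g x := by
  rw [MonoidAlgebra.of_apply, Representation.single_smul, one_smul]
  rfl

end AsModule

/-! ### Projectivity and the equivariant section of the boundary. -/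

section Lifting

variable {G : Type*} [Group G] [TopologicalSpace G] [IsTopologicalGroup G]

theorem isDiscreteModule_permRep {X : Type*} [MulAction G X]
    (hX : ∀ x : X, IsOpen (MulAction.stabilizer G x : Set G)) :
    IsDiscreteModule G (permRep G X).asModule := fun e => by
  have h : {g : G | MonoidAlgebra.of ℚ G g • e = e} = {g : G | permRep G X g e = e} :=
    Set.ext fun g => by
      change MonoidAlgebra.of ℚ G g • e = e ↔ permRep G X g e = e
      rw [of_smul_asModule]
      rfl
  rw [h]
  exact isOpen_fixing_permRep hX e

/-- Permutation modules with compact stabilizers are projective relative to discrete modules. -/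
theorem exists_lift_permRep {X : Type*} [MulAction G X]
    (hX : ∀ x : X, IsCompact (MulAction.stabilizer G x : Set G))
    {M N : Type*} [AddCommGroup M] [AddCommGroup N] [Module (MonoidAlgebra ℚ G) M]
    [Module (MonoidAlgebra ℚ G) N] (hM : IsDiscreteModule G M)
    (π : M →ₗ[MonoidAlgebra ℚ G] N) (f : (permRep G X).asModule →ₗ[MonoidAlgebra ℚ G] N)
    (h : ∀ x, ∃ m, π m = f x) :
    ∃ k : (permRep G X).asModule →ₗ[MonoidAlgebra ℚ G] M, ∀ x, π (k x) = f x := by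
  let _ : Module ℚ M := Module.compHom M (algebraMap ℚ (MonoidAlgebra ℚ G))
  let _ : Module ℚ N := Module.compHom N (algebraMap ℚ (MonoidAlgebra ℚ G))
  have : IsScalarTower ℚ (MonoidAlgebra ℚ G) M := IsScalarTower.of_algebraMap_smul fun _ _ => rfl
  have : IsScalarTower ℚ (MonoidAlgebra ℚ G) N := IsScalarTower.of_algebraMap_smul fun _ _ => rfl
  let ρ : Representation ℚ G M := Representation.ofModule' M
  have hρ : ∀ g m, ρ g m = MonoidAlgebra.of ℚ G g • m := fun g m => rfl
  let e : X → (permRep G X).asModule := fun x => (single x 1 : X →₀ ℚ)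
  have he : ∀ g x, e (g • x) = MonoidAlgebra.of ℚ G g • e x := fun g x => by
    rw [of_smul_asModule]; exact (permRep_single g x 1).symm
  -- The fibres of `π` over the images of basis elements are affine, hence convex; an equivariant
  -- choice on the basis is a lift.
  obtain ⟨φ, hφ, hφ'⟩ := exists_equivariant_selection (X := X) ρ hX hM
    (fun x => {m | π m = f (e x)}) (fun x a ha b hb s t _ _ hst => by
      change π (s • a + t • b) = f (e x)
      have ha' : π a = f (e x) := ha
      have hb' : π b = f (e x) := hb
      rw [map_add, LinearMap.map_smul_of_tower, LinearMap.map_smul_of_tower, ha', hb', ← add_smul,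
        hst, one_smul]) (fun x => h (e x)) (fun g x m hm => by
      change π (ρ g m) = f (e (g • x))
      have hm' : π m = f (e x) := hm
      rw [hρ, map_smul, hm', he, map_smul])
  let k₀ : (permRep G X).asModule →ₗ[ℚ] M := (linearCombination ℚ φ : (X →₀ ℚ) →ₗ[ℚ] M)
  have hk₀ : ∀ x, k₀ (e x) = φ x := fun x => by
    change linearCombination ℚ φ (single x 1) = φ x
    simp
  let k : (permRep G X).asModule →ₗ[MonoidAlgebra ℚ G] M :=
    MonoidAlgebra.equivariantOfLinearOfComm k₀ fun g v => by
      have : k₀ ∘ₗ (permRep G X g) = ρ g ∘ₗ k₀ := by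
        refine Finsupp.lhom_ext' fun x => LinearMap.ext_ring ?_
        have h1 : k₀ (e (g • x)) = ρ g (k₀ (e x)) := by rw [hk₀, hk₀, hφ']
        rw [he, of_smul_asModule] at h1
        exact h1
      have h2 := congr($this v)
      have h3 := of_smul_asModule (permRep G X) g v
      rw [MonoidAlgebra.of_apply] at h3
      rw [h3]
      exact h2
  refine ⟨k, fun x => ?_⟩
  have : (π.restrictScalars ℚ) ∘ₗ k₀ = (f.restrictScalars ℚ) := by
    refine Finsupp.lhom_ext' fun x => LinearMap.ext_ring ?_
    change π (k₀ (e x)) = f (e x)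
    rw [hk₀]
    exact hφ x
  exact congr($this x)

end Lifting

/-- The stabilizer of an element of a module over the group algebra. -/
def moduleStabilizer {G M : Type*} [Group G] [AddCommGroup M] [Module (MonoidAlgebra ℚ G) M]
    (m : M) : Subgroup G where
  carrier := {g : G | MonoidAlgebra.of ℚ G g • m = m}
  mul_mem' := fun {a b} ha hb => by
    simp only [Set.mem_ofPred_eq, map_mul, mul_smul] at *
    rw [hb, ha]
  one_mem' := by simp only [Set.mem_ofPred_eq, map_one, one_smul]
  inv_mem' := fun {a} ha => by
    simp only [Set.mem_ofPred_eq] at *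
    conv_lhs => rw [← ha]
    rw [← mul_smul, ← map_mul, inv_mul_cancel, map_one, one_smul]

/-- Here `N` may lie in another universe and `π` need not be onto. Replacing `N` by `M ⧸ ker π`, a
discrete module in the universe of `M`, reduces to the defining property. -/
theorem IsProjectiveDiscreteModule.exists_lift {G : Type u} [Group G] [TopologicalSpace G]
    {P M : Type u} {N : Type w} [AddCommGroup P] [AddCommGroup M] [AddCommGroup N]
    [Module (MonoidAlgebra ℚ G) P] [Module (MonoidAlgebra ℚ G) M] [Module (MonoidAlgebra ℚ G) N]
    (hP : IsProjectiveDiscreteModule G P) (hM : IsDiscreteModule G M)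
    (π : M →ₗ[MonoidAlgebra ℚ G] N) (f : P →ₗ[MonoidAlgebra ℚ G] N) (h : ∀ x, ∃ m, π m = f x)
    [IsTopologicalGroup G] :
    ∃ k : P →ₗ[MonoidAlgebra ℚ G] M, ∀ x, π (k x) = f x := by
  let f' : P →ₗ[MonoidAlgebra ℚ G] (M ⧸ LinearMap.ker π) :=
    π.quotKerEquivRange.symm.toLinearMap ∘ₗ f.codRestrict (LinearMap.range π) h
  have hdisc : IsDiscreteModule G (M ⧸ LinearMap.ker π) := by
    intro q
    obtain ⟨m, rfl⟩ := Submodule.Quotient.mk_surjective _ q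
    refine Subgroup.isOpen_mono (H₁ := moduleStabilizer m)
      (H₂ := moduleStabilizer (Submodule.Quotient.mk m : M ⧸ LinearMap.ker π)) (fun g hg => ?_)
      (hM m)
    have hg' : MonoidAlgebra.of ℚ G g • m = m := hg
    change MonoidAlgebra.of ℚ G g • (Submodule.Quotient.mk m : M ⧸ LinearMap.ker π) = _
    rw [← Submodule.Quotient.mk_smul, hg']
  obtain ⟨k, hk⟩ := hP.2 M _ hM hdisc (LinearMap.ker π).mkQ f' (Submodule.mkQ_surjective _)
  refine ⟨k, fun x => ?_⟩
  have h1 : (LinearMap.ker π).mkQ (k x) = f' x := congr($hk x)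
  have h2 := congr(((π.quotKerEquivRange) $h1 : N))
  simp [f'] at h2
  exact h2

section Stabilizers

variable {G : Type*} [Group G] {X Y : Type*} [MulAction G X] [MulAction G Y]

theorem coe_stabilizer_prod (a : X × Y) : (MulAction.stabilizer G a : Set G) =
    (MulAction.stabilizer G a.1 : Set G) ∩ (MulAction.stabilizer G a.2 : Set G) := by
  ext g
  simp [MulAction.mem_stabilizer_iff, Prod.ext_iff]

variable [TopologicalSpace G]

theorem isOpen_stabilizer_prod (hX : ∀ x : X, IsOpen (MulAction.stabilizer G x : Set G))
    (hY : ∀ x : Y, IsOpen (MulAction.stabilizer G x : Set G)) (a : X × Y) :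
    IsOpen (MulAction.stabilizer G a : Set G) := by
  rw [coe_stabilizer_prod]
  exact (hX _).inter (hY _)

theorem isCompact_stabilizer_prod [IsTopologicalGroup G]
    (hX : ∀ x : X, IsCompact (MulAction.stabilizer G x : Set G))
    (hY : ∀ x : Y, IsOpen (MulAction.stabilizer G x : Set G)) (a : X × Y) :
    IsCompact (MulAction.stabilizer G a : Set G) := by
  rw [coe_stabilizer_prod]
  exact (hX _).inter_right (Subgroup.isClosed_of_isOpen _ (hY _))

end Stabilizers

section Exactness

variable {V : Type*} [Nonempty V]

theorem exists_aug_eq (q : ℚ) : ∃ x, aug V x = q :=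
  ⟨single (Classical.arbitrary V) q, by simp [aug]⟩

theorem exists_bd1_eq (x : V →₀ ℚ) (hx : aug V x = 0) : ∃ y, bd1 V y = x :=
  ⟨cone0 (Classical.arbitrary V) x, by simp [bd1_cone0, hx]⟩

theorem exists_bd2_eq (x : V × V →₀ ℚ) (hx : bd1 V x = 0) : ∃ y, bd2 V y = x :=
  ⟨cone1 (Classical.arbitrary V) x, by simp [bd2_cone1, hx]⟩

end Exactness

/-- If `ℚ` has a discrete projective resolution of length at most two, the boundary map from
`2`-chains to `1`-cycles of the full simplex on a `G`-set with compact open stabilizers has an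
equivariant section. -/
theorem exists_equivariant_filling {G : Type u} [Group G] [TopologicalSpace G]
    [IsTopologicalGroup G] {V : Type u} [MulAction G V] [Nonempty V]
    (hc : ∀ x : V, IsCompact (MulAction.stabilizer G x : Set G))
    (ho : ∀ x : V, IsOpen (MulAction.stabilizer G x : Set G)) {n : ℕ} (hn : n ≤ 2)
    (hres : HasProjectiveResolutionOfLength G n) :
    ∃ s : (V × V →₀ ℚ) →ₗ[ℚ] (V × V × V →₀ ℚ), (∀ z, bd1 V z = 0 → bd2 V (s z) = z) ∧
      ∀ (g : G) z, bd1 V z = 0 →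
        s (permRep G (V × V) g z) = permRep G (V × V × V) g (s z) := by
  obtain ⟨P, _, _, d, ε, hP, hsub, hε, hex0, hex⟩ := hres
  have hc1 := isCompact_stabilizer_prod hc ho
  have ho1 := isOpen_stabilizer_prod ho ho
  have ho2 := isOpen_stabilizer_prod ho ho1
  let C0 := (permRep G V).asModule
  let C1 := (permRep G (V × V)).asModule
  let C2 := (permRep G (V × V × V)).asModule
  let b₁ : C1 →ₗ[MonoidAlgebra ℚ G] C0 := asModuleMap (bd1 V) bd1_permRep
  let b₂ : C2 →ₗ[MonoidAlgebra ℚ G] C1 := asModuleMap (bd2 V) bd2_permRep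
  let α : C0 →ₗ[MonoidAlgebra ℚ G] TrivialModule G := asModuleMap (aug V) aug_permRep
  have hαb : ∀ x, α (b₁ x) = 0 := aug_bd1
  have hα : ∀ q, ∃ x, α x = q := exists_aug_eq
  have h0 : ∀ x, α x = 0 → ∃ y, b₁ y = x := exists_bd1_eq
  have h1 : ∀ x, b₁ x = 0 → ∃ y, b₂ y = x := exists_bd2_eq
  have d0 : IsDiscreteModule G C0 := isDiscreteModule_permRep ho
  have d1 : IsDiscreteModule G C1 := isDiscreteModule_permRep ho1
  have d2 : IsDiscreteModule G C2 := isDiscreteModule_permRep ho2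
  -- The comparison theorem by hand: chain maps `f` from the simplex to `P` and `g` back, and a
  -- homotopy `k` from `g ∘ f` to the identity.
  obtain ⟨f₀, hf₀⟩ := exists_lift_permRep hc (hP 0).1 ε α fun x => hε _
  obtain ⟨f₁, hf₁⟩ := exists_lift_permRep hc1 (hP 1).1 (d 0) (f₀ ∘ₗ b₁) fun x =>
    (hex0 _).1 (by rw [LinearMap.comp_apply, hf₀, hαb])
  obtain ⟨g₀, hg₀⟩ := (hP 0).exists_lift d0 α ε fun x => hα _
  obtain ⟨g₁, hg₁⟩ := (hP 1).exists_lift d1 b₁ (g₀ ∘ₗ d 0) fun x =>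
    h0 _ (by rw [LinearMap.comp_apply, hg₀, hex0.apply_apply_eq_zero])
  obtain ⟨g₂, hg₂⟩ := (hP 2).exists_lift d2 b₂ (g₁ ∘ₗ d 1) fun x =>
    h1 _ (by rw [LinearMap.comp_apply, hg₁, LinearMap.comp_apply, (hex 0).apply_apply_eq_zero,
      map_zero])
  obtain ⟨k₀, hk₀⟩ := exists_lift_permRep hc d1 b₁ (LinearMap.id - g₀ ∘ₗ f₀) fun x =>
    h0 _ (by simp only [LinearMap.sub_apply, LinearMap.comp_apply, LinearMap.id_apply, map_sub,
      hg₀, hf₀, sub_self])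
  obtain ⟨k₁, hk₁⟩ := exists_lift_permRep hc1 d2 b₂ (LinearMap.id - g₁ ∘ₗ f₁ - k₀ ∘ₗ b₁) fun x =>
    h1 _ (by simp only [LinearMap.sub_apply, LinearMap.comp_apply, LinearMap.id_apply, map_sub,
      hg₁, hf₁, hk₀, sub_self])
  -- The only use of the dimension bound: `P 3` vanishes, so `d 1` is injective and can be inverted
  -- on its range.
  have : Subsingleton (P 3) := hsub 3 (by omega)
  have hinj : Function.Injective (d 1) := by
    rw [injective_iff_map_eq_zero]
    intro a ha
    obtain ⟨c, rfl⟩ := (hex 1 a).1 ha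
    rw [Subsingleton.elim c 0, map_zero]
  let e := LinearEquiv.ofInjective (d 1) hinj
  let φ : LinearMap.ker b₁ →ₗ[MonoidAlgebra ℚ G] P 2 := e.symm.toLinearMap ∘ₗ
    (f₁ ∘ₗ (LinearMap.ker b₁).subtype).codRestrict (LinearMap.range (d 1)) fun z =>
      (hex 0 _).1 (by
        simp only [LinearMap.comp_apply, Submodule.subtype_apply]
        rw [hf₁, LinearMap.comp_apply, z.2, map_zero])
  have hφ : ∀ z : LinearMap.ker b₁, d 1 (φ z) = f₁ z := fun z =>
    congrArg Subtype.val (e.apply_symm_apply _)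
  -- On a cycle the homotopy identity reads `z = g₁ (f₁ z) + b₂ (k₁ z)`, and `g₁ (f₁ z) = b₂ (g₂ (φ
  -- z))`.
  let s₀ : LinearMap.ker b₁ →ₗ[MonoidAlgebra ℚ G] C2 :=
    g₂ ∘ₗ φ + k₁ ∘ₗ (LinearMap.ker b₁).subtype
  have hs₀ : ∀ z : LinearMap.ker b₁, b₂ (s₀ z) = z := fun z => by
    have hz : b₁ z = 0 := z.2
    simp only [s₀, LinearMap.add_apply, LinearMap.comp_apply, map_add, hg₂, hφ, hk₁,
      LinearMap.sub_apply, LinearMap.id_apply, Submodule.subtype_apply, hz, map_zero]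
    abel
  let K : Submodule ℚ (V × V →₀ ℚ) := LinearMap.ker (bd1 V)
  let s₁ : K →ₗ[ℚ] (V × V × V →₀ ℚ) :=
    { toFun := fun z => s₀ ⟨z.1, z.2⟩
      map_add' := fun a b => s₀.map_add ⟨a.1, a.2⟩ ⟨b.1, b.2⟩
      map_smul' := fun c a => (s₀.restrictScalars ℚ).map_smul c ⟨a.1, a.2⟩ }
  -- The extension to all chains is merely `ℚ`-linear; equivariance is kept on cycles only.
  obtain ⟨s, hs⟩ := s₁.exists_extend
  have hs' : ∀ z (hz : bd1 V z = 0), s z = s₀ ⟨z, hz⟩ := fun z hz => congr($hs ⟨z, hz⟩)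
  refine ⟨s, fun z hz => ?_, fun g z hz => ?_⟩
  · rw [hs' z hz]
    exact hs₀ ⟨z, hz⟩
  · have hz' : bd1 V (permRep G (V × V) g z) = 0 := by rw [bd1_permRep, hz, map_zero]
    rw [hs' z hz, hs' _ hz']
    have h2 := s₀.map_smul (MonoidAlgebra.of ℚ G g) ⟨z, hz⟩
    have h3 := of_smul_asModule (permRep G (V × V × V)) g (s₀ ⟨z, hz⟩)
    rw [h3] at h2
    rw [← h2]
    congr 1
    exact Subtype.ext (of_smul_asModule (permRep G (V × V)) g z).symm

/-! ### Shortcuts in closed walks of a hyperbolic graph. -/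

section Walks

variable {V : Type*} {Γ : SimpleGraph V}

theorem exists_walk_split {a b : V} (p : Γ.Walk a b) {i : ℕ} (hi : i ≤ p.length) :
    ∃ (q : Γ.Walk a (p.getVert i)) (r : Γ.Walk (p.getVert i) b), q.length = i ∧
      p = q.append r := by
  induction p generalizing i with
  | nil =>
    obtain rfl : i = 0 := by simpa using hi
    exact ⟨.nil, .nil, rfl, rfl⟩
  | cons h p ih =>
    cases i with
    | zero => exact ⟨.nil, .cons h p, rfl, rfl⟩
    | succ i =>
      obtain ⟨q, r, hq, hp⟩ := ih (i := i) (by simpa using hi)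
      refine ⟨.cons h q, r, congrArg (· + 1) hq, ?_⟩
      conv_lhs => rw [hp]
      rfl

theorem exists_walk_split₃ {a b : V} (p : Γ.Walk a b) {i j : ℕ} (hij : i ≤ j)
    (hj : j ≤ p.length) :
    ∃ (q : Γ.Walk a (p.getVert i)) (m : Γ.Walk (p.getVert i) (p.getVert j))
      (r : Γ.Walk (p.getVert j) b), m.length = j - i ∧ p = q.append (m.append r) := by
  obtain ⟨q', r, hq', hp⟩ := exists_walk_split p hj
  obtain ⟨q, m, hq, hqm⟩ := exists_walk_split q' (i := i) (by omega)
  have hv : q'.getVert i = p.getVert i := by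
    conv_rhs => rw [hp]
    rw [SimpleGraph.Walk.getVert_append]
    split_ifs with h
    · rfl
    · have : i = q'.length := by omega
      rw [this]; simp
  refine ⟨q.copy rfl hv, m.copy hv rfl, r, ?_, ?_⟩
  · have := congrArg SimpleGraph.Walk.length hqm
    simp only [SimpleGraph.Walk.length_append, SimpleGraph.Walk.length_copy] at this ⊢
    omega
  · conv_lhs => rw [hp, hqm]
    rw [← SimpleGraph.Walk.append_assoc]
    generalize p.getVert i = x at *
    subst hv
    rfl

theorem dist_getVert_le {a b : V} (p : Γ.Walk a b) {i j : ℕ} (hij : i ≤ j)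
    (hj : j ≤ p.length) : Γ.dist (p.getVert i) (p.getVert j) ≤ j - i := by
  obtain ⟨q, m, r, hm, -⟩ := exists_walk_split₃ p hij hj
  exact hm ▸ SimpleGraph.dist_le m

theorem dist_add_dist_of_mem_geodesic {a b x : V} {p : Γ.Walk a b}
    (hp : p.length = Γ.dist a b) (hx : x ∈ p.support) :
    Γ.dist a x + Γ.dist x b = Γ.dist a b := by
  obtain ⟨q, r, rfl⟩ := SimpleGraph.Walk.mem_support_iff_exists_append.1 hx
  have h1 := SimpleGraph.dist_le q
  have h2 := SimpleGraph.dist_le r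
  rw [SimpleGraph.Walk.length_append] at hp
  have h3 := q.reachable.dist_triangle_left b
  omega

/-- A closed walk that is long compared with the slimness constant has a short subwalk that is
not geodesic. -/
theorem exists_shortcut (hconn : Γ.Connected) {δ : ℕ}
    (hδ : ∀ (x y z : V) (p : Γ.Walk x y) (q : Γ.Walk y z) (r : Γ.Walk x z),
      p.length = Γ.dist x y → q.length = Γ.dist y z → r.length = Γ.dist x z →
        ∀ a ∈ p.support, ∃ b, (b ∈ q.support ∨ b ∈ r.support) ∧ Γ.dist a b ≤ δ)
    {o : V} (p : Γ.Walk o o) (hp : 2 * δ + 1 ≤ p.length) :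
    ∃ i j, i ≤ j ∧ j ≤ p.length ∧ j - i ≤ 4 * δ + 2 ∧
      Γ.dist (p.getVert i) (p.getVert j) < j - i := by
  by_contra! hcon
  have hgeo : ∀ i j, i ≤ j → j ≤ p.length → j - i ≤ 4 * δ + 2 →
      Γ.dist (p.getVert i) (p.getVert j) = j - i := fun i j hij hj h =>
    le_antisymm (dist_getVert_le p hij hj) (hcon i j hij hj h)
  -- If all short subwalks were geodesic, slimness would fail at a vertex `c` of the walk farthest
  -- from `o`.
  obtain ⟨m, hm, hmax⟩ := Finset.exists_max_image (Finset.range (p.length + 1))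
    (fun i => Γ.dist o (p.getVert i)) ⟨0, by simp⟩
  have hm' : m ≤ p.length := by simpa [Nat.lt_succ_iff] using hm
  have hmax' : ∀ i ≤ p.length, Γ.dist o (p.getVert i) ≤ Γ.dist o (p.getVert m) := fun i hi =>
    hmax i (by simpa [Nat.lt_succ_iff] using hi)
  have h0 : ∀ i ≤ p.length, Γ.dist o (p.getVert i) ≤ i := fun i hi => by
    simpa using dist_getVert_le p (Nat.zero_le i) hi
  have h1 : ∀ i ≤ p.length, Γ.dist o (p.getVert i) ≤ p.length - i := fun i hi => by
    simpa [SimpleGraph.dist_comm] using dist_getVert_le p hi le_rfl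
  -- Some vertex is at distance `2 * δ + 1` from `o`, so `c` is at least that far from `o` and at
  -- least that many steps from both ends; the indices of `x` and `y` are not truncated.
  have ht := hgeo 0 (2 * δ + 1) (by omega) hp (by omega)
  rw [SimpleGraph.Walk.getVert_zero] at ht
  have ha := hmax' _ hp
  have hb := h0 m hm'
  have hc := h1 m hm'
  set x := p.getVert (m - (2 * δ + 1)) with hx
  set y := p.getVert (m + (2 * δ + 1)) with hy
  set c := p.getVert m with hcdef
  have hxc : Γ.dist x c = 2 * δ + 1 := by
    rw [hx, hgeo _ _ (by omega) hm' (by omega)]; omega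
  have hcy : Γ.dist c y = 2 * δ + 1 := by
    rw [hy, hgeo _ _ (by omega) (by omega) (by omega)]; omega
  have hxy : Γ.dist x y = 4 * δ + 2 := by
    rw [hx, hy, hgeo _ _ (by omega) (by omega) (by omega)]; omega
  obtain ⟨q₁, hq₁⟩ := hconn.exists_walk_length_eq_dist x c
  obtain ⟨q₂, hq₂⟩ := hconn.exists_walk_length_eq_dist c y
  obtain ⟨q, hq⟩ := hconn.exists_walk_length_eq_dist y o
  obtain ⟨r, hr⟩ := hconn.exists_walk_length_eq_dist x o
  obtain ⟨b, hb', hcb⟩ := hδ x y o (q₁.append q₂) q r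
    (by rw [SimpleGraph.Walk.length_append]; omega) hq hr c
    (by rw [SimpleGraph.Walk.mem_support_append_iff]; simp)
  -- A point `b` within `δ` of `c` is at least `δ + 1` from `z`. If it lies on a geodesic from `z`
  -- to `o`, then `c` is closer to `o` than `z` is, against maximality.
  have key : ∀ z : V, Γ.dist c z = 2 * δ + 1 → Γ.dist o z ≤ Γ.dist o c →
      ∀ k : Γ.Walk z o, k.length = Γ.dist z o → b ∈ k.support → False := by
    intro z hcz hzo k hk hbk
    have e1 := dist_add_dist_of_mem_geodesic hk hbk
    have e2 := hconn.dist_triangle (u := c) (v := b) (w := z)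
    have e3 := hconn.dist_triangle (u := o) (v := b) (w := c)
    rw [SimpleGraph.dist_comm (u := z) (v := b), SimpleGraph.dist_comm (u := z) (v := o),
      SimpleGraph.dist_comm (u := b) (v := o)] at e1
    rw [SimpleGraph.dist_comm (u := b) (v := c)] at e3
    omega
  rcases hb' with hb' | hb'
  · exact key y hcy (hmax' _ (by omega)) q hq hb'
  · exact key x (by rw [SimpleGraph.dist_comm]; exact hxc) (hmax' _ (by omega)) r hr hb'

end Walks

/-! ### The linear bound on closed walks. -/

section Filling

variable {V : Type*} {Γ : SimpleGraph V}

theorem bd2_single_self (a : V) : bd2 V (single (a, a, a) 1) = single (a, a) 1 := by simp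

theorem bd2_cone1_walkChain (o : V) {a b : V} (p : Γ.Walk a b) :
    bd2 V (cone1 o (walkChain p)) = walkChain p - single (o, b) 1 + single (o, a) 1 := by
  rw [bd2_cone1, bd1_walkChain, map_sub, cone0_single, cone0_single]
  abel

/-- A function on chains that behaves like a seminorm and is bounded on the boundaries of the
triangles of bounded size. -/
structure IsFillingNorm (Γ : SimpleGraph V) (N : (V × V →₀ ℚ) → ℚ) : Prop where
  zero : N 0 = 0
  add_le : ∀ x y, N (x + y) ≤ N x + N y
  neg : ∀ x, N (-x) = N x
  bounded : ∀ D : ℕ, ∃ B : ℚ, ∀ a b c, Γ.dist a b ≤ D → Γ.dist a c ≤ D →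
    N (bd2 V (single (a, b, c) 1)) ≤ B

namespace IsFillingNorm

variable {N : (V × V →₀ ℚ) → ℚ} (hN : IsFillingNorm Γ N)
include hN

theorem sub_le (x y : V × V →₀ ℚ) : N (x - y) ≤ N x + N y := by
  rw [sub_eq_add_neg, ← hN.neg y]
  exact hN.add_le _ _

theorem nonneg (x : V × V →₀ ℚ) : 0 ≤ N x := by
  have := hN.sub_le x x
  rw [sub_self, hN.zero] at this
  linarith

theorem cone_le {o : V} {D : ℕ} {B : ℚ} (hconn : Γ.Connected)
    (hB : ∀ a b c, Γ.dist a b ≤ D → Γ.dist a c ≤ D → N (bd2 V (single (a, b, c) 1)) ≤ B)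
    {a b : V} (p : Γ.Walk a b) (hp : Γ.dist o a + p.length ≤ D) :
    N (bd2 V (cone1 o (walkChain p))) ≤ p.length * B := by
  induction p with
  | nil => simp [hN.zero]
  | @cons x y z h p ih =>
    have h1 : Γ.dist o y ≤ Γ.dist o x + 1 := by
      have := hconn.dist_triangle (u := o) (v := x) (w := y)
      rwa [SimpleGraph.dist_eq_one_iff_adj.2 h] at this
    rw [SimpleGraph.Walk.length_cons] at hp ⊢
    have h2 := ih (by omega)
    rw [walkChain_cons, map_add, map_add, cone1_single]
    refine (hN.add_le _ _).trans ?_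
    push_cast
    linarith [hB o x y (by omega) (by omega)]

/-- The cone from `a` fills `p` against the edge `(a, b)` with one bounded triangle per step, up to
the degenerate edge `(a, a)`, itself the boundary of a degenerate triangle. -/
theorem exists_walkChain_sub_le (hconn : Γ.Connected) (L : ℕ) :
    ∃ B : ℚ, 0 ≤ B ∧ ∀ (a b : V) (p : Γ.Walk a b), p.length ≤ L →
      N (walkChain p - single (a, b) 1) ≤ B := by
  obtain ⟨B, hB⟩ := hN.bounded L
  have hB0 : ∀ a : V, N (single (a, a) 1) ≤ B := fun a => by
    simpa only [bd2_single_self] using hB a a a (by simp) (by simp)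
  obtain ⟨o⟩ := hconn.nonempty
  have hBnn : 0 ≤ B := (hN.nonneg _).trans (hB0 o)
  refine ⟨L * B + B, by positivity, fun a b p hp => ?_⟩
  have h1 := hN.cone_le hconn hB (o := a) p (by simpa using hp)
  rw [bd2_cone1_walkChain] at h1
  have h2 : walkChain p - single (a, b) (1 : ℚ) =
      (walkChain p - single (a, b) 1 + single (a, a) 1) - single (a, a) 1 := by abel
  rw [h2]
  refine (hN.sub_le _ _).trans (add_le_add (h1.trans ?_) (hB0 a))
  exact mul_le_mul_of_nonneg_right (by exact_mod_cast hp) hBnn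

/-- The linear homological isoperimetric inequality for closed walks in a hyperbolic graph. -/
theorem exists_linear_bound (hΓ : IsHyperbolicGraph Γ) :
    ∃ B : ℚ, 0 ≤ B ∧ ∀ (o : V) (p : Γ.Walk o o), N (walkChain p) ≤ B * p.length := by
  obtain ⟨hconn, δ, hδ⟩ := hΓ
  obtain ⟨B, hB, hNB⟩ := hN.exists_walkChain_sub_le hconn (4 * δ + 2)
  obtain ⟨B', hB'⟩ := hN.bounded 0
  have hB0 : ∀ a : V, N (single (a, a) 1) ≤ B' := fun a => by
    simpa only [bd2_single_self] using hB' a a a (by simp) (by simp)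
  obtain ⟨o⟩ := hconn.nonempty
  have hBnn : 0 ≤ B' := (hN.nonneg _).trans (hB0 o)
  -- Exchanging a subwalk for a geodesic costs at most `B + B` and saves at least one edge; `B + B'`
  -- covers nonempty walks too short to contain a shortcut.
  refine ⟨B + B + B', by positivity, ?_⟩
  suffices ∀ (n : ℕ) (o : V) (p : Γ.Walk o o), p.length = n →
      N (walkChain p) ≤ (B + B + B') * p.length from fun o p => this _ o p rfl
  intro n
  induction n using Nat.strong_induction_on with
  | _ n ih =>
  intro o p hpn
  rcases lt_or_ge p.length (2 * δ + 1) with hlt | hge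
  · rcases Nat.eq_zero_or_pos p.length with h0 | hpos
    · rw [SimpleGraph.Walk.eq_nil_iff_nil.2 (SimpleGraph.Walk.length_eq_zero_iff.1 h0),
        walkChain_nil, hN.zero]
      simp
    · have h1 := hNB o o p (by omega)
      have h2 : walkChain p = (walkChain p - single (o, o) 1) + single (o, o) 1 := by abel
      have h3 : (1 : ℚ) ≤ p.length := by exact_mod_cast hpos
      have h4 : N (walkChain p) ≤ B + B' := by
        rw [h2]; exact (hN.add_le _ _).trans (add_le_add h1 (hB0 o))
      nlinarith
  · obtain ⟨i, j, hij, hj, hle, hlt⟩ := exists_shortcut hconn hδ p hge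
    obtain ⟨q, m, r, hm, hp⟩ := exists_walk_split₃ p hij hj
    obtain ⟨m', hm'⟩ := hconn.exists_walk_length_eq_dist (p.getVert i) (p.getVert j)
    have hlen : (q.append (m'.append r)).length + 1 ≤ p.length := by
      have := congrArg SimpleGraph.Walk.length hp
      simp only [SimpleGraph.Walk.length_append] at this ⊢
      omega
    have h1 := ih _ (by omega) o (q.append (m'.append r)) rfl
    have h2 : walkChain p = walkChain (q.append (m'.append r)) +
        ((walkChain m - single (p.getVert i, p.getVert j) 1) -
          (walkChain m' - single (p.getVert i, p.getVert j) 1)) := by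
      conv_lhs => rw [hp]
      simp only [walkChain_append]
      abel
    have h3 := hNB _ _ m (by omega)
    have h4 := hNB _ _ m' (by omega)
    have h5 : (((q.append (m'.append r)).length : ℕ) : ℚ) + 1 ≤ p.length := by exact_mod_cast hlen
    have h6 := hN.add_le (walkChain (q.append (m'.append r)))
      ((walkChain m - single (p.getVert i, p.getVert j) 1) -
          (walkChain m' - single (p.getVert i, p.getVert j) 1))
    rw [← h2] at h6
    have h7 := hN.sub_le (walkChain m - single (p.getVert i, p.getVert j) 1)
      (walkChain m' - single (p.getVert i, p.getVert j) 1)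
    nlinarith

theorem exists_walk_near (hconn : Γ.Connected) {W : Type*} {Δ : SimpleGraph W} (ι : W → V) {k : ℕ}
    (hk : ∀ a b, Δ.Adj a b → Γ.dist (ι a) (ι b) ≤ k) :
    ∃ B : ℚ, 0 ≤ B ∧ ∀ (a b : W) (p : Δ.Walk a b), ∃ q : Γ.Walk (ι a) (ι b),
      q.length ≤ k * p.length ∧
        N ((walkChain p).mapDomain (Prod.map ι ι) - walkChain q) ≤ B * p.length := by
  obtain ⟨B, hB, hNB⟩ := hN.exists_walkChain_sub_le hconn k
  refine ⟨B, hB, fun a b p => ?_⟩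
  induction p with
  | nil => exact ⟨.nil, by simp, by simp [hN.zero]⟩
  | @cons x y z h p ih =>
    obtain ⟨q, hq, hpq⟩ := ih
    obtain ⟨r, hr⟩ := hconn.exists_walk_length_eq_dist (ι x) (ι y)
    have hrk : r.length ≤ k := hr ▸ hk x y h
    refine ⟨r.append q, ?_, ?_⟩
    · rw [SimpleGraph.Walk.length_append, SimpleGraph.Walk.length_cons, mul_add]
      omega
    · rw [walkChain_cons, Finsupp.mapDomain_add, Finsupp.mapDomain_single, walkChain_append]
      have h1 : single (Prod.map ι ι (x, y)) (1 : ℚ) + mapDomain (Prod.map ι ι) (walkChain p) -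
          (walkChain r + walkChain q) = (mapDomain (Prod.map ι ι) (walkChain p) - walkChain q) -
            (walkChain r - single (ι x, ι y) 1) := by
        rw [Prod.map_apply]; abel
      rw [h1, SimpleGraph.Walk.length_cons]
      push_cast
      linarith [hN.sub_le (mapDomain (Prod.map ι ι) (walkChain p) - walkChain q)
        (walkChain r - single (ι x, ι y) 1), hNB _ _ r hrk]

/-- Interpolating each edge of `Δ` by a geodesic of `Γ` reduces to closed walks of `Γ`. Only an
upper Lipschitz bound on `ι` is needed, so distortion is harmless. -/
theorem exists_linear_bound_map (hΓ : IsHyperbolicGraph Γ) {W : Type*} {Δ : SimpleGraph W}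
    (ι : W → V) {k : ℕ} (hk : ∀ a b, Δ.Adj a b → Γ.dist (ι a) (ι b) ≤ k) :
    ∃ B : ℚ, 0 ≤ B ∧ ∀ (o : W) (p : Δ.Walk o o),
      N ((walkChain p).mapDomain (Prod.map ι ι)) ≤ B * p.length := by
  obtain ⟨B, hB, h1⟩ := hN.exists_walk_near hΓ.1 ι hk
  obtain ⟨B', hB', h2⟩ := hN.exists_linear_bound hΓ
  refine ⟨B + B' * k, by positivity, fun o p => ?_⟩
  obtain ⟨q, hq, hpq⟩ := h1 o o p
  have h3 := hN.add_le ((walkChain p).mapDomain (Prod.map ι ι) - walkChain q) (walkChain q)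
  rw [sub_add_cancel] at h3
  have h4 : (q.length : ℚ) ≤ k * p.length := by exact_mod_cast hq
  have h5 := mul_le_mul_of_nonneg_left h4 hB'
  linarith [h2 _ q]

end IsFillingNorm

end Filling

/-! ### From linear filling to slim triangles. -/

section Slim

variable {W : Type*} {Δ : SimpleGraph W}

/-- Two vertices are equal or adjacent. -/
def AdjOrEq (Δ : SimpleGraph W) (a b : W) : Prop := a = b ∨ Δ.Adj a b

/-- The dual form of the linear homological isoperimetric inequality: cochains that are bounded by
`1` on the boundaries of triangles are bounded on closed walks by a multiple of the length. -/
def HasLinearFilling (Δ : SimpleGraph W) (C : ℕ) : Prop :=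
  ∀ L : (W × W →₀ ℚ) →ₗ[ℚ] ℚ,
    (∀ a b c, AdjOrEq Δ a b → AdjOrEq Δ b c → AdjOrEq Δ a c →
      |L (bd2 W (single (a, b, c) 1))| ≤ 1) →
    ∀ (o : W) (p : Δ.Walk o o), |L (walkChain p)| ≤ C * p.length

theorem AdjOrEq.dist_le_one {a b : W} (h : AdjOrEq Δ a b) : Δ.dist a b ≤ 1 := by
  rcases h with rfl | h
  · simp
  · exact (SimpleGraph.dist_eq_one_iff_adj.2 h).le

theorem exists_subgeodesic {a b s t : W} {p : Δ.Walk a b} (hp : p.length = Δ.dist a b)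
    (hs : s ∈ p.support) (ht : t ∈ p.support) :
    ∃ q : Δ.Walk s t, q.length = Δ.dist s t ∧ q.support ⊆ p.support := by
  obtain ⟨q, r, hqr⟩ := SimpleGraph.Walk.mem_support_iff_exists_append.1 hs
  rw [hqr, SimpleGraph.Walk.mem_support_append_iff] at ht
  rcases ht with ht | ht
  · obtain ⟨q₁, q₂, hq⟩ := SimpleGraph.Walk.mem_support_iff_exists_append.1 ht
    refine ⟨q₂.reverse, ?_, fun x hx => ?_⟩
    · rw [SimpleGraph.Walk.length_reverse, SimpleGraph.dist_comm]
      exact SimpleGraph.length_eq_dist_of_subwalk hp ⟨q₁, r, by rw [hqr, hq]⟩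
    · rw [SimpleGraph.Walk.support_reverse, List.mem_reverse] at hx
      simp [hqr, hq, SimpleGraph.Walk.mem_support_append_iff, hx]
  · obtain ⟨r₁, r₂, hr⟩ := SimpleGraph.Walk.mem_support_iff_exists_append.1 ht
    refine ⟨r₁, ?_, fun x hx => ?_⟩
    · exact SimpleGraph.length_eq_dist_of_subwalk hp ⟨q, r₂, by
        rw [hqr, hr, SimpleGraph.Walk.append_assoc]⟩
    · simp [hqr, hr, SimpleGraph.Walk.mem_support_append_iff, hx]

section Cochain

variable (Δ) (u p : W) (D : ℕ)

/-- The cochain `w dφ` for `w` the cut-off distance from `p` and `φ` the distance from `u`. -/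
noncomputable def cutoffCochain : (W × W →₀ ℚ) →ₗ[ℚ] ℚ :=
  linearCombination ℚ fun e =>
    ((D - Δ.dist p e.1 : ℕ) : ℚ) * ((Δ.dist u e.2 : ℚ) - Δ.dist u e.1)

variable {Δ u p D}

theorem cutoffCochain_single (a b : W) : cutoffCochain Δ u p D (single (a, b) 1) =
    ((D - Δ.dist p a : ℕ) : ℚ) * ((Δ.dist u b : ℚ) - Δ.dist u a) := by
  simp [cutoffCochain]

/-- The coboundary of `w dφ` is `dw ∪ dφ`, with value `(w b - w a) * (φ c - φ b)`; both `w` and `φ`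
are 1-Lipschitz. -/
theorem abs_cutoffCochain_bd2_le (hconn : Δ.Connected) {a b c : W} (hab : AdjOrEq Δ a b)
    (hbc : AdjOrEq Δ b c) : |cutoffCochain Δ u p D (bd2 W (single (a, b, c) 1))| ≤ 1 := by
  rw [bd2_single, map_add, map_sub, cutoffCochain_single, cutoffCochain_single,
    cutoffCochain_single]
  have h1 : ∀ x y z : W, AdjOrEq Δ y z → Δ.dist x y ≤ Δ.dist x z + 1 ∧
      Δ.dist x z ≤ Δ.dist x y + 1 := fun x y z h => by
    have e1 := h.dist_le_one
    have e2 := hconn.dist_triangle (u := x) (v := y) (w := z)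
    have e3 := hconn.dist_triangle (u := x) (v := z) (w := y)
    rw [SimpleGraph.dist_comm (u := z) (v := y)] at e3
    omega
  have h2 : |((D - Δ.dist p b : ℕ) : ℚ) - ((D - Δ.dist p a : ℕ) : ℚ)| ≤ 1 := by
    obtain ⟨e1, e2⟩ := h1 p a b hab
    have e3 : D - Δ.dist p b ≤ (D - Δ.dist p a) + 1 := by omega
    have e4 : D - Δ.dist p a ≤ (D - Δ.dist p b) + 1 := by omega
    have e3' : ((D - Δ.dist p b : ℕ) : ℚ) ≤ ((D - Δ.dist p a : ℕ) : ℚ) + 1 := by exact_mod_cast e3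
    have e4' : ((D - Δ.dist p a : ℕ) : ℚ) ≤ ((D - Δ.dist p b : ℕ) : ℚ) + 1 := by exact_mod_cast e4
    rw [abs_le]; constructor <;> linarith
  have h3 : |(Δ.dist u c : ℚ) - Δ.dist u b| ≤ 1 := by
    obtain ⟨e1, e2⟩ := h1 u b c hbc
    have e1' : (Δ.dist u b : ℚ) ≤ Δ.dist u c + 1 := by exact_mod_cast e1
    have e2' : (Δ.dist u c : ℚ) ≤ Δ.dist u b + 1 := by exact_mod_cast e2
    rw [abs_le]; constructor <;> linarith
  have h4 := mul_le_one₀ h2 (abs_nonneg _) h3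
  rw [← abs_mul] at h4
  refine le_of_eq_of_le (congrArg _ ?_) h4
  ring

theorem cutoffCochain_walkChain_eq_zero {a b : W} (q : Δ.Walk a b)
    (hq : ∀ x ∈ q.support, D ≤ Δ.dist p x) : cutoffCochain Δ u p D (walkChain q) = 0 := by
  induction q with
  | nil => simp
  | @cons x y z h q ih =>
    rw [walkChain_cons, map_add, cutoffCochain_single, ih fun x hx => hq x (by simp [hx])]
    have : D - Δ.dist p x = 0 := by have := hq x (by simp); omega
    simp [this]

theorem dist_eq_succ_of_cons (hconn : Δ.Connected) {o x y z : W} (h : Δ.Adj x y) (q : Δ.Walk y z)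
    (hq : Δ.dist o x + (SimpleGraph.Walk.cons h q).length = Δ.dist o z) :
    Δ.dist o y = Δ.dist o x + 1 ∧ Δ.dist o y + q.length = Δ.dist o z := by
  have e1 := hconn.dist_triangle (u := o) (v := x) (w := y)
  rw [SimpleGraph.dist_eq_one_iff_adj.2 h] at e1
  have e2 := hconn.dist_triangle (u := o) (v := y) (w := z)
  have e3 := SimpleGraph.dist_le q
  rw [SimpleGraph.Walk.length_cons] at hq
  omega

theorem cutoffCochain_walkChain_nonneg (hconn : Δ.Connected) {x z : W} (q : Δ.Walk x z)
    (hq : Δ.dist u x + q.length = Δ.dist u z) : 0 ≤ cutoffCochain Δ u p D (walkChain q) := by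
  induction q with
  | nil => simp
  | @cons x y z h q ih =>
    obtain ⟨h1, h2⟩ := dist_eq_succ_of_cons hconn h q hq
    rw [walkChain_cons, map_add, cutoffCochain_single, h1]
    push_cast
    rw [add_sub_cancel_left, mul_one]
    exact add_nonneg (by positivity) (ih h2)

/-- Along the walk `φ` grows by one and `w` drops by one at each step until it vanishes, so the
values sum to a triangular number. -/
theorem le_cutoffCochain_walkChain (hconn : Δ.Connected) {x z : W} (q : Δ.Walk x z)
    (hq : Δ.dist u x + q.length = Δ.dist u z) (hp : Δ.dist p x + q.length = Δ.dist p z)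
    (hD : D ≤ Δ.dist p z) :
    ((D - Δ.dist p x : ℕ) : ℚ) * (((D - Δ.dist p x : ℕ) : ℚ) + 1) ≤
      2 * cutoffCochain Δ u p D (walkChain q) := by
  induction q with
  | nil => simp [Nat.sub_eq_zero_of_le hD]
  | @cons x y z h q ih =>
    obtain ⟨h1, h2⟩ := dist_eq_succ_of_cons hconn h q hq
    obtain ⟨h3, h4⟩ := dist_eq_succ_of_cons hconn h q hp
    have := ih h2 h4 hD
    rw [walkChain_cons, map_add, cutoffCochain_single, h1]
    rcases Nat.eq_zero_or_pos (D - Δ.dist p x) with h0 | hpos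
    · have h0' : D - Δ.dist p y = 0 := by omega
      rw [h0'] at this
      rw [h0]
      push_cast at *
      linarith
    · have h0' : D - Δ.dist p x = (D - Δ.dist p y) + 1 := by omega
      rw [h0']
      push_cast
      linarith

end Cochain

/-- A detour around the ball of radius `D` centred on a geodesic has length at least quadratic
in `D`. -/
theorem HasLinearFilling.sq_le_detour {C : ℕ} (hC : HasLinearFilling Δ C) (hconn : Δ.Connected)
    {u v p : W} {D : ℕ} (α : Δ.Walk u v) (hα : α.length = Δ.dist u v) (hp : p ∈ α.support)
    (η : Δ.Walk v u) (hη : ∀ x ∈ η.support, D ≤ Δ.dist p x) :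
    D ^ 2 ≤ 2 * C * (α.length + η.length) := by
  have h1 := hC (cutoffCochain Δ u p D)
    (fun a b c hab hbc _ => abs_cutoffCochain_bd2_le hconn hab hbc) u (α.append η)
  obtain ⟨α₁, α₂, hα'⟩ := SimpleGraph.Walk.mem_support_iff_exists_append.1 hp
  have h2 := dist_add_dist_of_mem_geodesic hα hp
  have hlen : α.length = α₁.length + α₂.length := by rw [hα', SimpleGraph.Walk.length_append]
  have h3 := SimpleGraph.dist_le α₁
  have h4 := SimpleGraph.dist_le α₂
  have h5 := cutoffCochain_walkChain_nonneg (p := p) (D := D) (u := u) hconn α₁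
    (by rw [SimpleGraph.dist_self]; omega)
  have h6 := le_cutoffCochain_walkChain (p := p) (D := D) (u := u) hconn α₂
    (by omega) (by rw [SimpleGraph.dist_self]; omega) (hη v (by simp))
  rw [walkChain_append, map_add, cutoffCochain_walkChain_eq_zero η hη, add_zero, hα',
    walkChain_append, map_add, ← hα', SimpleGraph.Walk.length_append] at h1
  rw [SimpleGraph.dist_self, Nat.sub_zero] at h6
  have h7 := le_of_abs_le h1
  have h8 : (0 : ℚ) ≤ D := by positivity
  have h9 : (D : ℚ) ^ 2 ≤ 2 * C * (α.length + η.length) := by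
    push_cast at h7
    nlinarith
  exact_mod_cast h9

theorem exists_farthest_point {u v : W} (α : Δ.Walk u v) {S : Set W} (hS : S.Nonempty) :
    ∃ D, ∃ p ∈ α.support, (∀ s ∈ S, D ≤ Δ.dist p s) ∧
      ∀ x ∈ α.support, ∃ s ∈ S, Δ.dist x s ≤ D := by
  classical
  obtain ⟨p, hp, hmax⟩ := Finset.exists_max_image α.support.toFinset
    (fun x => sInf ((fun s => Δ.dist x s) '' S)) ⟨u, by simp⟩
  refine ⟨sInf ((fun s => Δ.dist p s) '' S), p, by simpa using hp,
    fun s hs => Nat.sInf_le ⟨s, hs, rfl⟩, fun x hx => ?_⟩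
  obtain ⟨s, hs, hxs⟩ := Nat.sInf_mem (hS.image fun s => Δ.dist x s)
  exact ⟨s, hs, hxs.le.trans (hmax x (by simpa using hx))⟩

/-- Follow `α` for `2 * D` steps, then jump to `S` by a path of length at most `D`; the jump cannot
enter the ball of radius `D` about `p`. If `α` ends earlier, its end already lies in `S`. -/
theorem exists_exit (hconn : Δ.Connected) {p v : W} (α : Δ.Walk p v)
    (hα : α.length = Δ.dist p v) {S : Set W} {D : ℕ} (hv : v ∈ S) (hpD : ∀ s ∈ S, D ≤ Δ.dist p s)
    (hD : ∀ x ∈ α.support, ∃ s ∈ S, Δ.dist x s ≤ D) :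
    ∃ (v₁ : W) (a : Δ.Walk p v₁) (r : Δ.Walk v₁ v), α = a.append r ∧ a.length ≤ 2 * D ∧
      ∃ s ∈ S, Δ.dist p s ≤ 3 * D ∧ ∃ b : Δ.Walk v₁ s, b.length ≤ D ∧
        ∀ x ∈ b.support, D ≤ Δ.dist p x := by
  rcases le_or_gt α.length (2 * D) with hle | hgt
  · exact ⟨v, α, .nil, by simp, hle, v, hv, by omega, .nil, by simp, by simpa using hpD v hv⟩
  · obtain ⟨a, r, ha, har⟩ := exists_walk_split α hgt.le
    obtain ⟨s, hs, hvs⟩ := hD _ (SimpleGraph.Walk.getVert_mem_support α (2 * D))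
    obtain ⟨b, hb⟩ := hconn.exists_walk_length_eq_dist (α.getVert (2 * D)) s
    have hdist : a.length = Δ.dist p (α.getVert (2 * D)) :=
      SimpleGraph.length_eq_dist_of_subwalk hα ⟨.nil, r, by simpa using har⟩
    refine ⟨_, a, r, har, ha.le, s, hs, ?_, b, by omega, fun x hx => ?_⟩
    · have := hconn.dist_triangle (u := p) (v := α.getVert (2 * D)) (w := s)
      omega
    · have h1 := dist_add_dist_of_mem_geodesic hb hx
      have h2 := hconn.dist_triangle (u := p) (v := x) (w := α.getVert (2 * D))
      rw [SimpleGraph.dist_comm (u := x)] at h2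
      omega

/-- Leave the ball in both directions along `α` and close up through `κ`. The term `6 * D` is two
geodesic pieces of length `2 * D` and two jumps of length `D`. -/
theorem HasLinearFilling.sq_le_of_farthest {C : ℕ} (hC : HasLinearFilling Δ C)
    (hconn : Δ.Connected) {u v p : W} {D L : ℕ} (α : Δ.Walk u v) (hα : α.length = Δ.dist u v)
    (hp : p ∈ α.support) {S : Set W} (hu : u ∈ S) (hv : v ∈ S) (hpD : ∀ s ∈ S, D ≤ Δ.dist p s)
    (hD : ∀ x ∈ α.support, ∃ s ∈ S, Δ.dist x s ≤ D)
    (hL : ∀ s ∈ S, ∀ t ∈ S, Δ.dist p s ≤ 3 * D → Δ.dist p t ≤ 3 * D →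
      ∃ κ : Δ.Walk s t, κ.length ≤ L ∧ ∀ x ∈ κ.support, D ≤ Δ.dist p x) :
    D ^ 2 ≤ 2 * C * (6 * D + L) := by
  obtain ⟨α₁, α₂, hα'⟩ := SimpleGraph.Walk.mem_support_iff_exists_append.1 hp
  have hα₁ : α₁.reverse.length = Δ.dist p u := by
    rw [SimpleGraph.Walk.length_reverse, SimpleGraph.dist_comm]
    exact SimpleGraph.length_eq_dist_of_subwalk hα ⟨.nil, α₂, by simpa using hα'⟩
  have hα₂ : α₂.length = Δ.dist p v :=
    SimpleGraph.length_eq_dist_of_subwalk hα ⟨α₁, .nil, by simpa using hα'⟩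
  obtain ⟨v₁, a, r, har, ha, t, ht, hpt, b, hb, hbD⟩ := exists_exit hconn α₂ hα₂ hv hpD
    fun x hx => hD x (by rw [hα', SimpleGraph.Walk.mem_support_append_iff]; exact Or.inr hx)
  obtain ⟨u₁, a', r', har', ha', s, hs, hps, b', hb', hbD'⟩ := exists_exit hconn α₁.reverse hα₁ hu
    hpD fun x hx => hD x (by
      rw [hα', SimpleGraph.Walk.mem_support_append_iff]; exact Or.inl (by simpa using hx))
  obtain ⟨κ, hκ, hκD⟩ := hL t ht s hs hpt hps
  have h1 : α₁ = r'.reverse.append a'.reverse := by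
    rw [← SimpleGraph.Walk.reverse_append, ← har', SimpleGraph.Walk.reverse_reverse]
  have hgeo : (a'.reverse.append a).length = Δ.dist u₁ v₁ :=
    SimpleGraph.length_eq_dist_of_subwalk hα ⟨r'.reverse, r, by
      rw [hα', h1, har]; simp only [SimpleGraph.Walk.append_assoc]⟩
  have h2 := hC.sq_le_detour hconn (a'.reverse.append a) hgeo (p := p) (D := D)
    (by rw [SimpleGraph.Walk.mem_support_append_iff]; simp)
    (b.append (κ.append b'.reverse)) (fun x hx => by
      simp only [SimpleGraph.Walk.mem_support_append_iff, SimpleGraph.Walk.support_reverse,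
        List.mem_reverse] at hx
      rcases hx with hx | hx | hx
      exacts [hbD x hx, hκD x hx, hbD' x hx])
  refine h2.trans (Nat.mul_le_mul_left _ ?_)
  simp only [SimpleGraph.Walk.length_append, SimpleGraph.Walk.length_reverse]
  omega

/-- Triangles with a short side are thin. -/
theorem HasLinearFilling.thin_of_short_side {C : ℕ} (hC : HasLinearFilling Δ C)
    (hconn : Δ.Connected) {u u' v : W} (α : Δ.Walk u v) (hα : α.length = Δ.dist u v)
    (β : Δ.Walk u' v) (hβ : β.length = Δ.dist u' v) (κ : Δ.Walk u u')
    (hκ : κ.length = Δ.dist u u') :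
    ∃ E : ℕ, E ^ 2 ≤ 2 * C * (12 * E + 2 * κ.length) ∧
      ∀ x ∈ α.support, ∃ s, (s ∈ β.support ∨ s ∈ κ.support) ∧ Δ.dist x s ≤ E := by
  obtain ⟨E, p, hp, hpE, hE⟩ := exists_farthest_point α (S := {s | s ∈ β.support ∨ s ∈ κ.support})
    ⟨u, Or.inr (by simp)⟩
  -- Points on different sides are joined along the sides through the common corner `u'`.
  have key : ∀ s ∈ κ.support, ∀ t ∈ β.support, Δ.dist s t ≤ 6 * E →
      ∃ q : Δ.Walk s t, q.length ≤ 6 * E + 2 * κ.length ∧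
        ∀ x ∈ q.support, x ∈ β.support ∨ x ∈ κ.support := fun s hs t ht hst => by
    obtain ⟨q₁, hq₁, hq₁'⟩ := exists_subgeodesic hκ hs (t := u') (by simp)
    obtain ⟨q₂, hq₂, hq₂'⟩ := exists_subgeodesic hβ (s := u') (by simp) ht
    refine ⟨q₁.append q₂, ?_, fun x hx => ?_⟩
    · have h1 := dist_add_dist_of_mem_geodesic hκ hs
      have h2 := hconn.dist_triangle (u := u') (v := s) (w := t)
      rw [SimpleGraph.dist_comm (u := u') (v := s)] at h2
      rw [SimpleGraph.Walk.length_append]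
      omega
    · rcases (SimpleGraph.Walk.mem_support_append_iff _ _).1 hx with hx | hx
      exacts [Or.inr (hq₁' hx), Or.inl (hq₂' hx)]
  refine ⟨E, (hC.sq_le_of_farthest hconn (L := 6 * E + 2 * κ.length) α hα hp (Or.inr (by simp))
    (Or.inl (by simp)) hpE hE fun s hs t ht hps hpt => ?_).trans_eq (by ring), hE⟩
  have hst := hconn.dist_triangle (u := s) (v := p) (w := t)
  rw [SimpleGraph.dist_comm (u := s) (v := p)] at hst
  suffices ∃ q : Δ.Walk s t, q.length ≤ 6 * E + 2 * κ.length ∧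
      ∀ x ∈ q.support, x ∈ β.support ∨ x ∈ κ.support by
    obtain ⟨q, hq, hqS⟩ := this
    exact ⟨q, hq, fun x hx => hpE x (hqS x hx)⟩
  rcases hs with hs | hs <;> rcases ht with ht | ht
  · obtain ⟨q, hq, hq'⟩ := exists_subgeodesic hβ hs ht
    exact ⟨q, by omega, fun x hx => Or.inl (hq' hx)⟩
  · obtain ⟨q, hq, hq'⟩ := key t ht s hs (by rw [SimpleGraph.dist_comm]; omega)
    exact ⟨q.reverse, by rwa [SimpleGraph.Walk.length_reverse],
      fun x hx => hq' x (by simpa using hx)⟩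
  · exact key s hs t ht (by omega)
  · obtain ⟨q, hq, hq'⟩ := exists_subgeodesic hκ hs ht
    exact ⟨q, by omega, fun x hx => Or.inr (hq' hx)⟩

/-- A connected graph with a linear homological isoperimetric inequality is hyperbolic. -/
theorem HasLinearFilling.isHyperbolicGraph {C : ℕ} (hC : HasLinearFilling Δ C)
    (hconn : Δ.Connected) : IsHyperbolicGraph Δ := by
  -- `76 = 2 * (6 + 32)`, where `32 * D` bounds the detour joining the two exit points.
  refine ⟨hconn, 76 * C, fun x y z α β γ hα hβ hγ => ?_⟩
  obtain ⟨D, p, hp, hpD, hD⟩ := exists_farthest_point α (S := {s | s ∈ β.support ∨ s ∈ γ.support})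
    ⟨x, Or.inr (by simp)⟩
  suffices hDC : D ≤ 76 * C from fun a ha => by
    obtain ⟨s, hs, has⟩ := hD a ha
    exact ⟨s, hs, has.trans hDC⟩
  by_contra! hDC
  have hD0 : 0 < D := by omega
  have key : ∀ s ∈ γ.support, ∀ t ∈ β.support, Δ.dist p s ≤ 3 * D → Δ.dist p t ≤ 3 * D →
      ∃ q : Δ.Walk s t, q.length ≤ 32 * D ∧ ∀ x ∈ q.support, D ≤ Δ.dist p x := by
    intro s hs t ht hps hpt
    have hst := hconn.dist_triangle (u := s) (v := p) (w := t)
    rw [SimpleGraph.dist_comm (u := s) (v := p)] at hst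
    obtain ⟨γ', hγ', hγS⟩ := exists_subgeodesic hγ hs (t := z) (by simp)
    obtain ⟨β', hβ', hβS⟩ := exists_subgeodesic hβ ht (t := z) (by simp)
    obtain ⟨κ, hκ⟩ := hconn.exists_walk_length_eq_dist s t
    obtain ⟨E, hE, hthin⟩ := hC.thin_of_short_side hconn γ' hγ' β' hβ' κ hκ
    -- `κ` has length at most `6 * D`, so `E > D` would give `E ≤ 48 * C < D`.
    have hED : E ≤ D := by
      by_contra! hlt
      have : E ^ 2 ≤ (48 * C) * E := hE.trans (by nlinarith)
      have : E ≤ 48 * C := by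
        rw [pow_two] at this
        exact Nat.le_of_mul_le_mul_right this (by omega)
      omega
    have hin : ∀ x, x ∈ γ'.support ∨ x ∈ β'.support → D ≤ Δ.dist p x := fun x hx =>
      hpD x (hx.elim (fun h => Or.inr (hγS h)) fun h => Or.inl (hβS h))
    -- A short `γ'` is followed to the corner `z`. Otherwise cross to `β'` at distance `12 * D` from
    -- `s`: this point is too far from `s` to be within `D` of `κ`, and far enough from `p` for the
    -- crossing to avoid the ball. The length is at most `12 * D + D + 19 * D`.
    rcases le_or_gt γ'.length (12 * D) with hle | hgt
    · refine ⟨γ'.append β'.reverse, ?_, fun x hx => hin x ?_⟩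
      · have := hconn.dist_triangle (u := t) (v := s) (w := z)
        rw [SimpleGraph.dist_comm (u := t) (v := s)] at this
        rw [SimpleGraph.Walk.length_append, SimpleGraph.Walk.length_reverse]
        omega
      · simpa [SimpleGraph.Walk.mem_support_append_iff] using hx
    · obtain ⟨w, a, r, ha, har⟩ : ∃ (w : W) (a : Δ.Walk s w) (r : Δ.Walk w z),
          a.length = 12 * D ∧ γ' = a.append r := ⟨_, exists_walk_split γ' hgt.le⟩
      have hw : w ∈ γ'.support := by rw [har, SimpleGraph.Walk.mem_support_append_iff]; simp
      have haw : a.length = Δ.dist s w :=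
        SimpleGraph.length_eq_dist_of_subwalk hγ' ⟨.nil, r, by simpa using har⟩
      have haS : a.support ⊆ γ'.support := fun x hx => by
        rw [har, SimpleGraph.Walk.mem_support_append_iff]; exact Or.inl hx
      obtain ⟨w', hw', hww'⟩ := hthin w hw
      rcases hw' with hw' | hw'
      · obtain ⟨b, hb, hbS⟩ := exists_subgeodesic hβ' hw' (t := t) (by simp)
        obtain ⟨c, hc⟩ := hconn.exists_walk_length_eq_dist w w'
        refine ⟨a.append (c.append b), ?_, fun x hx => ?_⟩
        · have h1 := hconn.dist_triangle (u := w') (v := w) (w := t)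
          have h2 := hconn.dist_triangle (u := w) (v := s) (w := t)
          rw [SimpleGraph.dist_comm (u := w') (v := w)] at h1
          rw [SimpleGraph.dist_comm (u := w) (v := s)] at h2
          simp only [SimpleGraph.Walk.length_append]
          omega
        · simp only [SimpleGraph.Walk.mem_support_append_iff] at hx
          rcases hx with hx | hx | hx
          · exact hin x (Or.inl (haS hx))
          · have h1 := dist_add_dist_of_mem_geodesic hc hx
            have h2 := hconn.dist_triangle (u := s) (v := p) (w := w)
            have h3 := hconn.dist_triangle (u := p) (v := x) (w := w)
            rw [SimpleGraph.dist_comm (u := s) (v := p)] at h2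
            rw [SimpleGraph.dist_comm (u := x) (v := w)] at h3
            omega
          · exact hin x (Or.inr (hbS hx))
      · have h1 := dist_add_dist_of_mem_geodesic hκ hw'
        have h2 := hconn.dist_triangle (u := s) (v := w') (w := w)
        rw [SimpleGraph.dist_comm (u := w') (v := w)] at h2
        omega
  have hsq : D ^ 2 ≤ 2 * C * (6 * D + 32 * D) :=
    hC.sq_le_of_farthest hconn α hα hp (Or.inr (by simp)) (Or.inl (by simp)) hpD hD
      fun s hs t ht hps hpt => by
        have hst := hconn.dist_triangle (u := s) (v := p) (w := t)
        rw [SimpleGraph.dist_comm (u := s) (v := p)] at hst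
        rcases hs with hs | hs <;> rcases ht with ht | ht
        · obtain ⟨q, hq, hq'⟩ := exists_subgeodesic hβ hs ht
          exact ⟨q, by omega, fun x hx => hpD x (Or.inl (hq' hx))⟩
        · obtain ⟨q, hq, hq'⟩ := key t ht s hs hpt hps
          exact ⟨q.reverse, by rwa [SimpleGraph.Walk.length_reverse],
            fun x hx => hq' x (by simpa using hx)⟩
        · exact key s hs t ht hps hpt
        · obtain ⟨q, hq, hq'⟩ := exists_subgeodesic hγ hs ht
          exact ⟨q, by omega, fun x hx => hpD x (Or.inr (hq' hx))⟩
  have : D ≤ 76 * C := Nat.le_of_mul_le_mul_right (c := D) (by nlinarith) hD0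
  omega

end Slim

/-! ### Word balls of a compact generating set. -/

section WordBall

variable {H : Type*} [Group H]

/-- The elements of a group that are values of words of length at most `n` in the letters `K`. -/
def wordBall (K : Set H) (n : ℕ) : Set H :=
  {x | ∃ l : List (K × Bool), l.length ≤ n ∧
    FreeGroup.lift (Subtype.val : K → H) (FreeGroup.mk l) = x}

variable {K : Set H}

theorem one_mem_wordBall (n : ℕ) : (1 : H) ∈ wordBall K n := ⟨[], by simp, by simp⟩

theorem wordBall_mono {m n : ℕ} (h : m ≤ n) : wordBall K m ⊆ wordBall K n :=
  fun _ ⟨l, hl, hx⟩ => ⟨l, hl.trans h, hx⟩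

theorem mul_mem_wordBall {m n : ℕ} {x y : H} (hx : x ∈ wordBall K m) (hy : y ∈ wordBall K n) :
    x * y ∈ wordBall K (m + n) := by
  obtain ⟨l, hl, rfl⟩ := hx
  obtain ⟨l', hl', rfl⟩ := hy
  exact ⟨l ++ l', by rw [List.length_append]; omega, by rw [← FreeGroup.mul_mk, map_mul]⟩

theorem inv_mem_wordBall {n : ℕ} {x : H} (hx : x ∈ wordBall K n) : x⁻¹ ∈ wordBall K n := by
  obtain ⟨l, hl, rfl⟩ := hx
  exact ⟨FreeGroup.invRev l, by rwa [FreeGroup.invRev_length], by rw [← FreeGroup.inv_mk, map_inv]⟩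

theorem inv_mem_wordBall_iff {n : ℕ} {x : H} : x⁻¹ ∈ wordBall K n ↔ x ∈ wordBall K n :=
  ⟨fun h => by simpa using inv_mem_wordBall h, inv_mem_wordBall⟩

theorem wordBall_succ (n : ℕ) : wordBall K (n + 1) = (K ∪ K⁻¹ ∪ {1}) * wordBall K n := by
  ext x
  constructor
  · rintro ⟨l, hl, rfl⟩
    rcases l with _ | ⟨⟨k, b⟩, l⟩
    · exact ⟨1, by simp, 1, one_mem_wordBall n, by simp⟩
    · refine ⟨FreeGroup.lift (Subtype.val : K → H) (FreeGroup.mk [(k, b)]), ?_,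
        _, ⟨l, by simpa using hl, rfl⟩, ?_⟩
      · cases b <;> simp
      · change FreeGroup.lift _ _ * FreeGroup.lift _ _ = _
        rw [← map_mul, FreeGroup.mul_mk]
        rfl
  · rintro ⟨a, ha, y, hy, rfl⟩
    have h1 : a ∈ wordBall K 1 := by
      rcases ha with (ha | ha) | ha
      · exact ⟨[(⟨a, ha⟩, true)], by simp, by simp⟩
      · exact ⟨[(⟨a⁻¹, ha⟩, false)], by simp, by simp⟩
      · rw [Set.mem_singleton_iff.1 ha]; exact one_mem_wordBall 1
    have := mul_mem_wordBall h1 hy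
    rwa [add_comm] at this

theorem exists_mem_wordBall
    (hsurj : Function.Surjective (FreeGroup.lift (Subtype.val : K → H))) (x : H) :
    ∃ n, x ∈ wordBall K n := by
  obtain ⟨y, rfl⟩ := hsurj x
  obtain ⟨l, rfl⟩ := Quot.exists_rep y
  exact ⟨l.length, l, le_rfl, rfl⟩

variable [TopologicalSpace H] [IsTopologicalGroup H]

theorem isCompact_wordBall (hK : IsCompact K) (n : ℕ) : IsCompact (wordBall K n) := by
  induction n with
  | zero =>
    have : wordBall K 0 = {1} := by
      ext x
      constructor
      · rintro ⟨l, hl, rfl⟩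
        rw [List.length_eq_zero_iff.1 (Nat.le_zero.1 hl)]
        simp
      · rintro rfl
        exact one_mem_wordBall 0
    rw [this]
    exact isCompact_singleton
  | succ n ih =>
    rw [wordBall_succ]
    exact ((hK.union hK.inv).union isCompact_singleton).mul ih

/-- By Baire some compact word ball has interior; translates show that the interiors of the balls
exhaust the group. -/
theorem exists_subset_wordBall [T2Space H] [LocallyCompactSpace H] (hK : IsCompact K)
    (hsurj : Function.Surjective (FreeGroup.lift (Subtype.val : K → H))) {U : Set H}
    (hU : IsCompact U) : ∃ n, U ⊆ wordBall K n := by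
  obtain ⟨m, x, hx⟩ := nonempty_interior_of_iUnion_of_closed
    (fun n => (isCompact_wordBall hK n).isClosed)
    (Set.eq_univ_of_forall fun x => Set.mem_iUnion.2 (exists_mem_wordBall hsurj x))
  have hxm : x⁻¹ ∈ wordBall K m := inv_mem_wordBall (interior_subset hx)
  have hcover : U ⊆ ⋃ n, interior (wordBall K n) := fun u _ => by
    obtain ⟨n, hn⟩ := exists_mem_wordBall hsurj u
    refine Set.mem_iUnion.2 ⟨n + m + m, mem_interior.2
      ⟨(fun y => x * u⁻¹ * y) ⁻¹' interior (wordBall K m), fun y hy => ?_,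
        isOpen_interior.preimage (continuous_const_mul _), by simpa using hx⟩⟩
    have h1 : x * u⁻¹ * y ∈ wordBall K m := interior_subset hy
    have h2 := mul_mem_wordBall (mul_mem_wordBall hn hxm) h1
    simpa [mul_assoc] using h2
  obtain ⟨t, ht⟩ := hU.elim_directed_cover _ (fun n => isOpen_interior) hcover
    (directed_of_isDirected_le fun i j hij => interior_mono (wordBall_mono hij))
  exact ⟨t, ht.trans interior_subset⟩

end WordBall

/-! ### Closed cochains on a presented group are exact. -/

section Potential

variable {H : Type*} [Group H] {K : Set H} {Q : Type*} [AddCommGroup Q]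

/-- The permutation of `H × Q` by which a letter acts on the covering defined by a cochain. -/
def coverPerm (c : H → H → Q) (k : H) : Equiv.Perm (H × Q) where
  toFun p := (p.1 * k⁻¹, p.2 + c p.1 (p.1 * k⁻¹))
  invFun p := (p.1 * k, p.2 - c (p.1 * k) p.1)
  left_inv p := by simp
  right_inv p := by simp

theorem coverPerm_apply (c : H → H → Q) (k : H) (p : H × Q) :
    coverPerm c k p = (p.1 * k⁻¹, p.2 + c p.1 (p.1 * k⁻¹)) := rfl

theorem coverPerm_inv_apply (c : H → H → Q) (k : H) (p : H × Q) :
    (coverPerm c k)⁻¹ p = (p.1 * k, p.2 - c (p.1 * k) p.1) := rfl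

/-- A cochain on a group with a presentation by relators of length at most `m` that is closed on
triangles of diameter at most `m` is exact. -/
theorem exists_potential {R : Set (FreeGroup K)} {m : ℕ}
    (hR : ∀ r ∈ R, ∃ l : List (K × Bool), l.length ≤ m ∧ FreeGroup.mk l = r)
    (hsurj : Function.Surjective (FreeGroup.lift (Subtype.val : K → H)))
    (hker : Subgroup.normalClosure R = (FreeGroup.lift (Subtype.val : K → H)).ker)
    (c : H → H → Q)
    (hc : ∀ g₁ g₂ g₃, g₁⁻¹ * g₂ ∈ wordBall K m → g₂⁻¹ * g₃ ∈ wordBall K m →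
      g₁⁻¹ * g₃ ∈ wordBall K m → c g₂ g₃ - c g₁ g₃ + c g₁ g₂ = 0) :
    ∃ θ : H → Q, ∀ g₁ g₂, g₁⁻¹ * g₂ ∈ wordBall K m → c g₁ g₂ = θ g₂ - θ g₁ := by
  set π := FreeGroup.lift (Subtype.val : K → H) with hπ
  -- The monodromy of the covering of `H` with fibre `Q` defined by `c`. By `hword`, closedness
  -- evaluates a word of length at most `m` in a single step, so relators act trivially and `σ`
  -- factors through `H`.
  let σ : FreeGroup K →* Equiv.Perm (H × Q) := FreeGroup.lift fun k : K => coverPerm c k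
  have hrefl : ∀ g, c g g = 0 := fun g => by
    have := hc g g g (by simp [one_mem_wordBall]) (by simp [one_mem_wordBall])
      (by simp [one_mem_wordBall])
    simpa using this
  have hsymm : ∀ g₁ g₂, g₁⁻¹ * g₂ ∈ wordBall K m → c g₂ g₁ = - c g₁ g₂ := fun g₁ g₂ h => by
    have := hc g₁ g₂ g₁ h (by rw [← inv_mem_wordBall_iff]; simpa using h)
      (by simp [one_mem_wordBall])
    rw [hrefl, sub_zero] at this
    exact eq_neg_of_add_eq_zero_left this
  have hword : ∀ l : List (K × Bool), l.length ≤ m → ∀ g q,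
      σ (FreeGroup.mk l) (g, q) =
        (g * (π (FreeGroup.mk l))⁻¹, q + c g (g * (π (FreeGroup.mk l))⁻¹)) := by
    intro l
    induction l with
    | nil =>
      intro _ g q
      rw [← FreeGroup.one_eq_mk]
      simp [hrefl]
    | cons x l ih =>
      intro hl g q
      have hl' : l.length + 1 ≤ m := by simpa using hl
      have h1 : FreeGroup.mk (x :: l) = FreeGroup.mk [x] * FreeGroup.mk l := by
        rw [FreeGroup.mul_mk]; rfl
      have hx : π (FreeGroup.mk [x]) ∈ wordBall K m := ⟨[x], by simp; omega, rfl⟩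
      have hstep : ∀ g q, σ (FreeGroup.mk [x]) (g, q) =
          (g * (π (FreeGroup.mk [x]))⁻¹, q + c g (g * (π (FreeGroup.mk [x]))⁻¹)) := by
        intro g q
        obtain ⟨k, b⟩ := x
        cases b
        · have e1 : π (FreeGroup.mk [(k, false)]) = (k : H)⁻¹ := by simp [hπ]
          have e2 : σ (FreeGroup.mk [(k, false)]) = (coverPerm c k)⁻¹ := by simp [σ]
          rw [e1] at hx ⊢
          rw [e2, coverPerm_inv_apply, inv_inv, hsymm g (g * k)
            (by rw [← inv_mem_wordBall_iff]; simpa using hx), sub_neg_eq_add]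
        · have e1 : π (FreeGroup.mk [(k, true)]) = (k : H) := by simp [hπ]
          have e2 : σ (FreeGroup.mk [(k, true)]) = coverPerm c k := by simp [σ]
          rw [e1, e2, coverPerm_apply]
      have hL : π (FreeGroup.mk l) ∈ wordBall K m := ⟨l, by omega, rfl⟩
      have hxL : π (FreeGroup.mk [x]) * π (FreeGroup.mk l) ∈ wordBall K m :=
        ⟨x :: l, hl, by rw [h1, map_mul]⟩
      rw [h1, map_mul, map_mul, Equiv.Perm.mul_apply, ih (by omega), hstep, mul_inv_rev]
      refine Prod.ext (by simp [mul_assoc]) ?_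
      have := hc g (g * (π (FreeGroup.mk l))⁻¹)
        (g * (π (FreeGroup.mk l))⁻¹ * (π (FreeGroup.mk [x]))⁻¹)
        (by simpa using inv_mem_wordBall hL) (by simpa [mul_assoc] using inv_mem_wordBall hx)
        (by simpa [mul_assoc] using inv_mem_wordBall hxL)
      simp only [← mul_assoc]
      rw [add_assoc]
      congr 1
      rw [← sub_eq_zero, ← this]
      abel
  have hle : π.ker ≤ σ.ker := by
    rw [← hker]
    refine Subgroup.normalClosure_le_normal fun r hr => ?_
    obtain ⟨l, hl, rfl⟩ := hR r hr
    have h1 : π (FreeGroup.mk l) = 1 := by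
      have : FreeGroup.mk l ∈ π.ker := hker ▸ Subgroup.subset_normalClosure hr
      exact this
    refine MonoidHom.mem_ker.2 (Equiv.ext fun p => ?_)
    obtain ⟨g, q⟩ := p
    rw [hword l hl, h1]
    simp [hrefl]
  have hσπ : ∀ x y, π x = π y → σ x = σ y := fun x y h => by
    have h1 : x⁻¹ * y ∈ π.ker := by rw [MonoidHom.mem_ker, map_mul, map_inv, h, inv_mul_cancel]
    have h2 := MonoidHom.mem_ker.1 (hle h1)
    rw [map_mul, map_inv, inv_mul_eq_one] at h2
    exact h2
  have hfst : ∀ x p, (σ x p).1 = p.1 * (π x)⁻¹ := by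
    intro x
    induction x using FreeGroup.induction_on with
    | C1 => simp
    | of k => intro p; simp [σ, hπ, coverPerm_apply]
    | inv_of k _ => intro p; simp [σ, hπ, coverPerm_inv_apply]
    | mul x y hx hy => intro p; simp [hx, hy, mul_assoc]
  -- Words act on the base by right multiplication with the inverse, so a word for `g⁻¹` carries the
  -- base point `(1, 0)` to the fibre over `g`.
  choose lft hlft using fun g : H => hsurj g⁻¹
  refine ⟨fun g => (σ (lft g) (1, 0)).2, fun g₁ g₂ h => ?_⟩
  obtain ⟨l, hl, hlx⟩ := inv_mem_wordBall h
  have h1 : σ (lft g₁) (1, 0) = (g₁, (σ (lft g₁) (1, 0)).2) :=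
    Prod.ext (by rw [hfst, hlft]; simp) rfl
  have h2 : σ (lft g₂) = σ (FreeGroup.mk l) * σ (lft g₁) := by
    rw [← map_mul]
    refine hσπ _ _ ?_
    rw [map_mul, hlft, hlft, hlx]
    simp
  dsimp only
  rw [h2, Equiv.Perm.mul_apply, h1, hword l hl, hlx]
  simp

end Potential

/-! ### The complex of related triples on an orbit. -/

section WordRel

variable {H : Type*} [Group H] {V : Type*} [MulAction H V]

/-- Two points `g₁ v` and `g₂ v` of an orbit are related if `g₁⁻¹ g₂` can be chosen of word length
at most `m`. -/
def WordRel (K : Set H) (m : ℕ) (v a b : V) : Prop :=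
  ∃ g₁ g₂ : H, g₁⁻¹ * g₂ ∈ wordBall K m ∧ g₁ • v = a ∧ g₂ • v = b

variable {K : Set H} {m : ℕ} {v : V}

theorem WordRel.symm {a b : V} (h : WordRel K m v a b) : WordRel K m v b a := by
  obtain ⟨g₁, g₂, h, rfl, rfl⟩ := h
  exact ⟨g₂, g₁, by simpa using inv_mem_wordBall h, rfl, rfl⟩

theorem wordRel_refl (g : H) : WordRel K m v (g • v) (g • v) :=
  ⟨g, g, by simp [one_mem_wordBall], rfl, rfl⟩

theorem WordRel.smul {a b : V} (h : WordRel K m v a b) (g : H) :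
    WordRel K m v (g • a) (g • b) := by
  obtain ⟨g₁, g₂, h, rfl, rfl⟩ := h
  exact ⟨g * g₁, g * g₂, by simpa [mul_assoc] using h, mul_smul _ _ _, mul_smul _ _ _⟩

theorem wordRel_smul_iff {a b : V} (g : H) :
    WordRel K m v (g • a) (g • b) ↔ WordRel K m v a b :=
  ⟨fun h => by simpa using h.smul g⁻¹, fun h => h.smul g⟩

theorem WordRel.left_mem {a b : V} (h : WordRel K m v a b) : a ∈ MulAction.orbit H v := by
  obtain ⟨g₁, g₂, -, rfl, -⟩ := h
  exact ⟨g₁, rfl⟩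

theorem WordRel.right_mem {a b : V} (h : WordRel K m v a b) : b ∈ MulAction.orbit H v :=
  h.symm.left_mem

/-- The triples of pairwise related points. -/
def relTriples (K : Set H) (m : ℕ) (v : V) : Set (V × V × V) :=
  {t | WordRel K m v t.1 t.2.1 ∧ WordRel K m v t.2.1 t.2.2 ∧ WordRel K m v t.1 t.2.2}

theorem smul_mem_relTriples {t : V × V × V} (ht : t ∈ relTriples K m v) (g : H) :
    g • t ∈ relTriples K m v :=
  ⟨ht.1.smul g, ht.2.1.smul g, ht.2.2.smul g⟩

/-- The potential on `H` descends to the orbit: as the stabilizer lies in the word ball, potentials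
at two lifts of a point differ by a value of `c` on a degenerate edge, which is zero. -/
theorem exists_vertex_potential {Q : Type*} [AddCommGroup Q] {R : Set (FreeGroup K)}
    (hR : ∀ r ∈ R, ∃ l : List (K × Bool), l.length ≤ m ∧ FreeGroup.mk l = r)
    (hsurj : Function.Surjective (FreeGroup.lift (Subtype.val : K → H)))
    (hker : Subgroup.normalClosure R = (FreeGroup.lift (Subtype.val : K → H)).ker)
    (hv : (MulAction.stabilizer H v : Set H) ⊆ wordBall K m) (c : V → V → Q)
    (hc : ∀ t ∈ relTriples K m v, c t.2.1 t.2.2 - c t.1 t.2.2 + c t.1 t.2.1 = 0) :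
    ∃ ψ : V → Q, ∀ a b, WordRel K m v a b → c a b = ψ b - ψ a := by
  classical
  obtain ⟨θ, hθ⟩ := exists_potential hR hsurj hker (fun g₁ g₂ => c (g₁ • v) (g₂ • v))
    fun g₁ g₂ g₃ h₁ h₂ h₃ => hc (g₁ • v, g₂ • v, g₃ • v)
      ⟨⟨_, _, h₁, rfl, rfl⟩, ⟨_, _, h₂, rfl, rfl⟩, ⟨_, _, h₃, rfl, rfl⟩⟩
  have hdesc : ∀ g₁ g₂ : H, g₁ • v = g₂ • v → θ g₁ = θ g₂ := fun g₁ g₂ h => by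
    have h1 : g₁⁻¹ * g₂ ∈ wordBall K m := hv (by
      rw [SetLike.mem_coe, MulAction.mem_stabilizer_iff, mul_smul, ← h, inv_smul_smul])
    have h2 := hθ g₁ g₂ h1
    have h3 := hc (g₁ • v, g₁ • v, g₁ • v) ⟨wordRel_refl _, wordRel_refl _, wordRel_refl _⟩
    simp only [sub_self, zero_add] at h3
    rw [← h, h3] at h2
    exact (sub_eq_zero.1 h2.symm).symm
  refine ⟨fun a => if h : ∃ g : H, g • v = a then θ h.choose else 0, fun a b hab => ?_⟩
  obtain ⟨g₁, g₂, h, rfl, rfl⟩ := hab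
  have e1 : ∃ g : H, g • v = g₁ • v := ⟨g₁, rfl⟩
  have e2 : ∃ g : H, g • v = g₂ • v := ⟨g₂, rfl⟩
  dsimp only
  rw [dif_pos e1, dif_pos e2, hdesc _ g₁ e1.choose_spec, hdesc _ g₂ e2.choose_spec]
  exact hθ g₁ g₂ h

/-- The chains that are carried by pairs of related points. -/
noncomputable def relChains (K : Set H) (m : ℕ) (v : V) : Submodule ℚ (V × V →₀ ℚ) :=
  supported ℚ ℚ {e | WordRel K m v e.1 e.2}

/-- The span of the boundaries of triples of related points. -/
noncomputable def relBoundaries (K : Set H) (m : ℕ) (v : V) : Submodule ℚ (V × V →₀ ℚ) :=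
  Submodule.span ℚ ((fun t => bd2 V (single t 1)) '' relTriples K m v)

/-- The complex of related triples has no homology in degree one. -/
theorem mem_relBoundaries {R : Set (FreeGroup K)}
    (hR : ∀ r ∈ R, ∃ l : List (K × Bool), l.length ≤ m ∧ FreeGroup.mk l = r)
    (hsurj : Function.Surjective (FreeGroup.lift (Subtype.val : K → H)))
    (hker : Subgroup.normalClosure R = (FreeGroup.lift (Subtype.val : K → H)).ker)
    (hv : (MulAction.stabilizer H v : Set H) ⊆ wordBall K m) {z : V × V →₀ ℚ}
    (hz : z ∈ relChains K m v) (hz0 : bd1 V z = 0) : z ∈ relBoundaries K m v := by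
  -- The universal closed cochain, an edge modulo boundaries, has a potential, so it vanishes on
  -- cycles.
  let q := (relBoundaries K m v).mkQ
  obtain ⟨ψ, hψ⟩ := exists_vertex_potential hR hsurj hker hv (fun a b => q (single (a, b) 1))
    fun t ht => by
      rw [← map_sub, ← map_add, ← bd2_single]
      exact (Submodule.Quotient.mk_eq_zero _).2 (Submodule.subset_span ⟨t, ht, rfl⟩)
  have key : ∀ x ∈ relChains K m v, q x = linearCombination ℚ ψ (bd1 V x) := by
    intro x hx
    rw [relChains, supported_eq_span_single] at hx
    induction hx using Submodule.span_induction with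
    | mem x hx =>
      obtain ⟨⟨a, b⟩, he, rfl⟩ := hx
      rw [hψ _ _ he, bd1_single]
      simp
    | zero => simp
    | add x y _ _ hx hy => simp [hx, hy]
    | smul a x _ hx => simp [hx]
  have := key z hz
  rw [hz0, map_zero] at this
  exact (Submodule.Quotient.mk_eq_zero _).1 this

theorem single_sub_single_mem_map (hm : 1 ≤ m)
    (hsurj : Function.Surjective (FreeGroup.lift (Subtype.val : K → H))) (g : H) :
    single (g • v) 1 - single v 1 ∈ (relChains K m v).map (bd1 V) := by
  obtain ⟨x, rfl⟩ := hsurj g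
  obtain ⟨l, rfl⟩ := Quot.exists_rep x
  change single (FreeGroup.lift (Subtype.val : K → H) (FreeGroup.mk l) • v) 1 - _ ∈ _
  induction l using List.reverseRecOn with
  | nil => rw [← FreeGroup.one_eq_mk, map_one, one_smul, sub_self]; exact Submodule.zero_mem _
  | append_singleton l x ih =>
    have h1 : WordRel K m v (FreeGroup.lift (Subtype.val : K → H) (FreeGroup.mk l) • v)
        (FreeGroup.lift (Subtype.val : K → H) (FreeGroup.mk (l ++ [x])) • v) :=
      ⟨_, _, ⟨[x], by simpa using hm, by
        rw [← FreeGroup.mul_mk, map_mul, inv_mul_cancel_left]⟩, rfl, rfl⟩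
    rw [← sub_add_sub_cancel _ (single (FreeGroup.lift (Subtype.val : K → H)
      (FreeGroup.mk l) • v) (1 : ℚ))]
    refine Submodule.add_mem _ ⟨_, ?_, bd1_single _ _⟩ ih
    exact single_mem_supported ℚ 1 h1

theorem mem_map_bd1_relChains (hm : 1 ≤ m)
    (hsurj : Function.Surjective (FreeGroup.lift (Subtype.val : K → H))) {x : V →₀ ℚ}
    (hx : x ∈ supported ℚ ℚ (MulAction.orbit H v)) (hx0 : aug V x = 0) :
    x ∈ (relChains K m v).map (bd1 V) := by
  have key : ∀ y ∈ supported ℚ ℚ (MulAction.orbit H v),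
      y - aug V y • single v 1 ∈ (relChains K m v).map (bd1 V) := by
    intro y hy
    rw [supported_eq_span_single] at hy
    induction hy using Submodule.span_induction with
    | mem y hy =>
      obtain ⟨_, ⟨g, rfl⟩, rfl⟩ := hy
      rw [aug_single, one_smul]
      exact single_sub_single_mem_map hm hsurj g
    | zero => simp
    | add y z _ _ hy hz =>
      have := Submodule.add_mem _ hy hz
      rwa [sub_add_sub_comm, ← add_smul, ← map_add] at this
    | smul a y _ hy =>
      have := Submodule.smul_mem _ a hy
      rwa [smul_sub, smul_smul, ← smul_eq_mul, ← map_smul] at this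
  have := key x hx
  rwa [hx0, zero_smul, sub_zero] at this

section Topology

variable [TopologicalSpace H] [IsTopologicalGroup H]

theorem isLocallyConstant_smul {x : V} (hx : IsOpen (MulAction.stabilizer H x : Set H)) :
    IsLocallyConstant fun g : H => g • x := by
  rw [IsLocallyConstant.iff_exists_open]
  intro g
  refine ⟨(fun h => g⁻¹ * h) ⁻¹' (MulAction.stabilizer H x : Set H),
    hx.preimage (continuous_const_mul _), by simp, fun h hh => ?_⟩
  have h1 : (g⁻¹ * h) • x = x := hh
  rwa [mul_smul, inv_smul_eq_iff] at h1

theorem finite_setOf_wordRel (hK : IsCompact K)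
    (hc : IsCompact (MulAction.stabilizer H v : Set H))
    (ho : IsOpen (MulAction.stabilizer H v : Set H)) : {b | WordRel K m v v b}.Finite := by
  refine (finite_image_of_isLocallyConstant (isLocallyConstant_smul ho)
    (hc.mul (isCompact_wordBall hK m))).subset ?_
  rintro b ⟨g₁, g₂, h, h₁, rfl⟩
  exact ⟨g₂, ⟨g₁, h₁, g₁⁻¹ * g₂, h, by simp⟩, rfl⟩

theorem exists_finite_relTriples (hK : IsCompact K)
    (hc : IsCompact (MulAction.stabilizer H v : Set H))
    (ho : IsOpen (MulAction.stabilizer H v : Set H)) :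
    ∃ T : Set (V × V × V), T.Finite ∧ ∀ t ∈ relTriples K m v, ∃ g : H, ∃ t' ∈ T, g • t' = t := by
  have hfin := finite_setOf_wordRel (m := m) hK hc ho
  refine ⟨{v} ×ˢ ({b | WordRel K m v v b} ×ˢ {b | WordRel K m v v b}),
    (Set.finite_singleton v).prod (hfin.prod hfin), ?_⟩
  rintro ⟨a, b, c⟩ ⟨h1, -, h2⟩
  obtain ⟨g, rfl⟩ := h1.left_mem
  exact ⟨g, (v, g⁻¹ • b, g⁻¹ • c), ⟨rfl, by simpa using h1.smul g⁻¹, by simpa using h2.smul g⁻¹⟩,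
    by simp⟩

end Topology

/-- The graph on an orbit whose edges are the pairs of related points. -/
def orbitGraph (K : Set H) (m : ℕ) (v : V) : SimpleGraph (MulAction.orbit H v) where
  Adj a b := a ≠ b ∧ WordRel K m v a b
  symm := ⟨fun _ _ h => ⟨h.1.symm, h.2.symm⟩⟩
  loopless := ⟨fun _ h => h.1 rfl⟩

theorem adjOrEq_orbitGraph_iff {a b : MulAction.orbit H v} :
    AdjOrEq (orbitGraph K m v) a b ↔ WordRel K m v a b := by
  constructor
  · rintro (rfl | h)
    · obtain ⟨_, g, rfl⟩ := a
      exact wordRel_refl g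
    · exact h.2
  · intro h
    by_cases hab : a = b
    exacts [Or.inl hab, Or.inr ⟨hab, h⟩]

theorem connected_orbitGraph (hm : 1 ≤ m)
    (hsurj : Function.Surjective (FreeGroup.lift (Subtype.val : K → H))) :
    (orbitGraph K m v).Connected := by
  have h : ∀ g : H, (orbitGraph K m v).Reachable ⟨v, MulAction.mem_orbit_self v⟩
      ⟨g • v, MulAction.mem_orbit v g⟩ := by
    intro g
    obtain ⟨x, rfl⟩ := hsurj g
    obtain ⟨l, rfl⟩ := Quot.exists_rep x
    change (orbitGraph K m v).Reachable _
      ⟨FreeGroup.lift (Subtype.val : K → H) (FreeGroup.mk l) • v, _⟩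
    induction l using List.reverseRecOn with
    | nil =>
      have : FreeGroup.lift (Subtype.val : K → H) (FreeGroup.mk []) • v = v := by
        rw [← FreeGroup.one_eq_mk, map_one, one_smul]
      simp only [this]
      exact SimpleGraph.Reachable.refl _
    | append_singleton l x ih =>
      refine ih.trans ?_
      have h1 : WordRel K m v (FreeGroup.lift (Subtype.val : K → H) (FreeGroup.mk l) • v)
          (FreeGroup.lift (Subtype.val : K → H) (FreeGroup.mk (l ++ [x])) • v) :=
        ⟨_, _, ⟨[x], by simpa using hm, by
          rw [← FreeGroup.mul_mk, map_mul, inv_mul_cancel_left]⟩, rfl, rfl⟩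
      have h2 : AdjOrEq (orbitGraph K m v)
          ⟨_, MulAction.mem_orbit v (FreeGroup.lift (Subtype.val : K → H) (FreeGroup.mk l))⟩
          ⟨_, MulAction.mem_orbit v (FreeGroup.lift (Subtype.val : K → H)
            (FreeGroup.mk (l ++ [x])))⟩ := adjOrEq_orbitGraph_iff.2 h1
      rcases h2 with h2 | h2
      · rw [h2]
      · exact h2.reachable
  have : Nonempty (MulAction.orbit H v) := ⟨⟨v, MulAction.mem_orbit_self v⟩⟩
  refine ⟨fun a b => ?_⟩
  obtain ⟨_, g₁, rfl⟩ := a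
  obtain ⟨_, g₂, rfl⟩ := b
  exact (h g₁).symm.trans (h g₂)

theorem isCayleyAbelsGraph_orbitGraph [TopologicalSpace H] [IsTopologicalGroup H] (hm : 1 ≤ m)
    (hK : IsCompact K) (hsurj : Function.Surjective (FreeGroup.lift (Subtype.val : K → H)))
    (hc : ∀ x : V, IsCompact (MulAction.stabilizer H x : Set H))
    (ho : ∀ x : V, IsOpen (MulAction.stabilizer H x : Set H)) :
    IsCayleyAbelsGraph H (orbitGraph K m v) where
  connected := connected_orbitGraph hm hsurj
  locally_finite := by
    rintro ⟨_, g, rfl⟩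
    refine Set.Finite.of_finite_image (f := Subtype.val) ?_ Subtype.val_injective.injOn
    refine ((finite_setOf_wordRel (m := m) hK (hc v) (ho v)).image (g • ·)).subset ?_
    rintro _ ⟨b, hb, rfl⟩
    exact ⟨g⁻¹ • (b : V), by simpa using WordRel.smul hb.2 g⁻¹, by simp⟩
  adj_smul_iff g x y := by
    change (g • x ≠ g • y ∧ WordRel K m v (g • (x : V)) (g • (y : V))) ↔ _
    rw [wordRel_smul_iff, (MulAction.injective g).ne_iff]
    rfl
  transitive := fun x y => MulAction.exists_smul_eq H x y
  isCompact_stabilizer x := by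
    have : MulAction.stabilizer H x = MulAction.stabilizer H (x : V) := by
      ext g; simp [MulAction.mem_stabilizer_iff, Subtype.ext_iff]
    rw [this]; exact hc _
  isOpen_stabilizer x := by
    have : MulAction.stabilizer H x = MulAction.stabilizer H (x : V) := by
      ext g; simp [MulAction.mem_stabilizer_iff, Subtype.ext_iff]
    rw [this]; exact ho _

end WordRel

section Equivariance

variable {H : Type*} [Group H] {X Y : Type*} [MulAction H X] [MulAction H Y]

theorem linearCombination_permRep {E : Type*} [AddCommGroup E] [Module ℚ E]
    (ρ : Representation ℚ H E) {f : X → E} (hf : ∀ g x, f (g • x) = ρ g (f x)) (g : H)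
    (z : X →₀ ℚ) :
    linearCombination ℚ f (permRep H X g z) = ρ g (linearCombination ℚ f z) := by
  have : linearCombination ℚ f ∘ₗ permRep H X g = ρ g ∘ₗ linearCombination ℚ f := by
    ext x; simp [hf]
  exact congr($this z)

theorem smul_mem_orbit_iff {g : H} {a b : X} :
    g • a ∈ MulAction.orbit H b ↔ a ∈ MulAction.orbit H b := by
  rw [← MulAction.orbit_eq_iff, ← MulAction.orbit_eq_iff, MulAction.orbit_smul]

theorem permRep_mem_supported {s : Set X} {g : H} (hs : ∀ x ∈ s, g • x ∈ s) {z : X →₀ ℚ}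
    (hz : z ∈ supported ℚ ℚ s) : permRep H X g z ∈ supported ℚ ℚ s := by
  rw [mem_supported] at *
  intro i hi
  obtain ⟨j, hj, rfl⟩ := mem_support_permRep hi
  exact hs j (hz hj)

theorem permRep_mem_relChains {K : Set H} {m : ℕ} {x : X} (g : H) {z : X × X →₀ ℚ}
    (hz : z ∈ relChains K m x) : permRep H (X × X) g z ∈ relChains K m x :=
  permRep_mem_supported (s := {e : X × X | WordRel K m x e.1 e.2})
    (fun _ he => WordRel.smul he g) hz

end Equivariance

/-! ### Equivariant retraction onto related cycles. -/

section Retraction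

variable {H : Type*} [Group H] [TopologicalSpace H] [IsTopologicalGroup H] {V : Type*}
  [MulAction H V] {K : Set H} {m : ℕ} {v : V}

theorem exists_vertex_retraction (hc : ∀ x : V, IsCompact (MulAction.stabilizer H x : Set H))
    (ho : ∀ x : V, IsOpen (MulAction.stabilizer H x : Set H)) (v : V) :
    ∃ r : V → (V →₀ ℚ), (∀ a, aug V (r a) = 1) ∧
      (∀ a, r a ∈ supported ℚ ℚ (MulAction.orbit H v)) ∧
      (∀ a ∈ MulAction.orbit H v, r a = single a 1) ∧
      ∀ (g : H) a, r (g • a) = permRep H V g (r a) := by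
  suffices ∃ r : V → (V →₀ ℚ), (∀ a, r a ∈ {x | aug V x = 1 ∧
      x ∈ supported ℚ ℚ (MulAction.orbit H v) ∧ (a ∈ MulAction.orbit H v → x = single a 1)}) ∧
      ∀ (g : H) a, r (g • a) = permRep H V g (r a) by
    obtain ⟨r, hr, hr'⟩ := this
    exact ⟨r, fun a => (hr a).1, fun a => (hr a).2.1, fun a => (hr a).2.2, hr'⟩
  refine exists_equivariant_selection (permRep H V) hc (isOpen_fixing_permRep ho) _ ?_ ?_ ?_
  · rintro a x ⟨hx1, hx2, hx3⟩ y ⟨hy1, hy2, hy3⟩ s t _ _ hst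
    refine ⟨by rw [map_add, map_smul, map_smul, hx1, hy1]; simpa using hst,
      Submodule.add_mem _ (Submodule.smul_mem _ _ hx2) (Submodule.smul_mem _ _ hy2), fun ha => ?_⟩
    rw [hx3 ha, hy3 ha, ← add_smul, hst, one_smul]
  · intro a
    by_cases ha : a ∈ MulAction.orbit H v
    · exact ⟨single a 1, aug_single a, single_mem_supported ℚ 1 ha, fun _ => rfl⟩
    · exact ⟨single v 1, aug_single v, single_mem_supported ℚ 1 (MulAction.mem_orbit_self v),
        fun h => absurd h ha⟩
  · rintro g a x ⟨hx1, hx2, hx3⟩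
    refine ⟨by rw [aug_permRep, hx1], permRep_mem_supported (fun y hy => ?_) hx2, fun ha => ?_⟩
    · exact (smul_mem_orbit_iff).2 hy
    · rw [hx3 ((smul_mem_orbit_iff).1 ha), permRep_single]

/-- The cycles carried by pairs of related points are an equivariant retract of all cycles. -/
theorem exists_cycle_retraction (hm : 1 ≤ m)
    (hsurj : Function.Surjective (FreeGroup.lift (Subtype.val : K → H)))
    (hc : ∀ x : V, IsCompact (MulAction.stabilizer H x : Set H))
    (ho : ∀ x : V, IsOpen (MulAction.stabilizer H x : Set H)) :
    ∃ r : (V × V →₀ ℚ) →ₗ[ℚ] (V × V →₀ ℚ), (∀ z, bd1 V z = 0 → bd1 V (r z) = 0) ∧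
      (∀ z, r z ∈ relChains K m v) ∧ (∀ z ∈ relChains K m v, r z = z) ∧
      ∀ (g : H) z, r (permRep H (V × V) g z) = permRep H (V × V) g (r z) := by
  obtain ⟨r₀, haug, hsupp, hid, hequi⟩ := exists_vertex_retraction hc ho v
  -- Each edge goes to a related chain with the boundary prescribed by `r₀`, and to itself if it is
  -- related. These conditions are convex, so the choice can be made equivariantly.
  suffices ∃ r : V × V → (V × V →₀ ℚ), (∀ e, r e ∈ {x | bd1 V x = r₀ e.2 - r₀ e.1 ∧
      x ∈ relChains K m v ∧ (WordRel K m v e.1 e.2 → x = single e 1)}) ∧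
      ∀ (g : H) e, r (g • e) = permRep H (V × V) g (r e) by
    obtain ⟨r, hr, hr'⟩ := this
    refine ⟨linearCombination ℚ r, fun z hz => ?_, fun z => ?_, fun z hz => ?_,
      linearCombination_permRep _ hr'⟩
    · have : bd1 V ∘ₗ linearCombination ℚ r = linearCombination ℚ r₀ ∘ₗ bd1 V := by
        refine Finsupp.lhom_ext' fun e => LinearMap.ext_ring ?_
        obtain ⟨a, b⟩ := e
        simp [(hr (a, b)).1]
      have h1 := congr($this z)
      simpa [hz] using h1
    · rw [linearCombination_apply]
      exact Submodule.sum_mem _ fun e _ => Submodule.smul_mem _ _ (hr e).2.1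
    · conv_rhs => rw [← Finsupp.sum_single z]
      rw [linearCombination_apply]
      refine Finset.sum_congr rfl fun e he => ?_
      dsimp only
      rw [(hr e).2.2 ((mem_supported ℚ z).1 hz he), Finsupp.smul_single_one]
  refine exists_equivariant_selection (X := V × V) (permRep H (V × V))
    (isCompact_stabilizer_prod hc ho) (isOpen_fixing_permRep (isOpen_stabilizer_prod ho ho)) _
    ?_ ?_ ?_
  · rintro e x ⟨hx1, hx2, hx3⟩ y ⟨hy1, hy2, hy3⟩ s t _ _ hst
    refine ⟨by rw [map_add, map_smul, map_smul, hx1, hy1, ← add_smul, hst, one_smul],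
      Submodule.add_mem _ (Submodule.smul_mem _ _ hx2) (Submodule.smul_mem _ _ hy2), fun ha => ?_⟩
    rw [hx3 ha, hy3 ha, ← add_smul, hst, one_smul]
  · rintro ⟨a, b⟩
    by_cases hab : WordRel K m v a b
    · exact ⟨single (a, b) 1, by rw [bd1_single, hid a hab.left_mem, hid b hab.right_mem],
        single_mem_supported ℚ 1 hab, fun _ => rfl⟩
    · obtain ⟨x, hx, hx'⟩ := mem_map_bd1_relChains hm hsurj (x := r₀ b - r₀ a)
        (Submodule.sub_mem _ (hsupp b) (hsupp a)) (by rw [map_sub, haug, haug, sub_self])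
      exact ⟨x, hx', hx, fun h => absurd h hab⟩
  · rintro g ⟨a, b⟩ x ⟨hx1, hx2, hx3⟩
    refine ⟨?_, permRep_mem_relChains g hx2, fun ha => ?_⟩
    · change _ = r₀ (g • b) - r₀ (g • a)
      rw [bd1_permRep, hx1, hequi, hequi, map_sub]
    · rw [hx3 ((wordRel_smul_iff g).1 ha), permRep_single]

end Retraction

/-! ### Comparison of fillings in the orbit and in the simplex. -/

section Bound

variable {H : Type*} [Group H] {V : Type*} [MulAction H V] {K : Set H} {m : ℕ} {v : V}

/-- The functionals that are bounded by `1` on boundaries of triples of related points. -/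
def IsUnitFunctional (K : Set H) (m : ℕ) (v : V) (L : (V × V →₀ ℚ) →ₗ[ℚ] ℚ) : Prop :=
  ∀ t ∈ relTriples K m v, |L (bd2 V (single t 1))| ≤ 1

/-- One expression of `z` by related triples serves all functionals and all translates at once. -/
theorem exists_bound_on_translates {z : V × V →₀ ℚ} (hz : z ∈ relBoundaries K m v) :
    ∃ M : ℚ, ∀ L, IsUnitFunctional K m v L → ∀ g : H, |L (permRep H (V × V) g z)| ≤ M := by
  induction hz using Submodule.span_induction with
  | mem z hz =>
    obtain ⟨t, ht, rfl⟩ := hz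
    refine ⟨1, fun L hL g => ?_⟩
    dsimp only
    rw [← bd2_permRep, permRep_single]
    exact hL _ (smul_mem_relTriples ht g)
  | zero => exact ⟨0, fun L _ g => by simp⟩
  | add x y _ _ hx hy =>
    obtain ⟨M, hM⟩ := hx
    obtain ⟨M', hM'⟩ := hy
    refine ⟨M + M', fun L hL g => ?_⟩
    rw [map_add, map_add]
    exact (abs_add_le _ _).trans (add_le_add (hM L hL g) (hM' L hL g))
  | smul a x _ hx =>
    obtain ⟨M, hM⟩ := hx
    refine ⟨|a| * M, fun L hL g => ?_⟩
    rw [map_smul, map_smul, smul_eq_mul, abs_mul]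
    exact mul_le_mul_of_nonneg_left (hM L hL g) (abs_nonneg a)

theorem walkChain_map_mem_relChains {a b : MulAction.orbit H v}
    (p : (orbitGraph K m v).Walk a b) :
    (walkChain p).mapDomain (Prod.map Subtype.val Subtype.val) ∈ relChains K m v := by
  classical
  rw [relChains, mem_supported]
  intro e he
  obtain ⟨x, hx, rfl⟩ := Finset.mem_image.1 (Finsupp.mapDomain_support he)
  exact (mem_support_walkChain p hx).2

theorem bd1_mapDomain {X Y : Type*} (f : X → Y) (z : X × X →₀ ℚ) :
    bd1 Y (z.mapDomain (Prod.map f f)) = (bd1 X z).mapDomain f := by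
  have : bd1 Y ∘ₗ lmapDomain ℚ ℚ (Prod.map f f) = lmapDomain ℚ ℚ f ∘ₗ bd1 X := by
    ext1 ⟨a, b⟩; ext1; simp [Finsupp.mapDomain_sub]
  exact congr($this z)

theorem bd2_mapDomain_single {X Y : Type*} (f : X → Y) (a b c : X) :
    (bd2 X (single (a, b, c) 1)).mapDomain (Prod.map f f) = bd2 Y (single (f a, f b, f c) 1) := by
  simp [Finsupp.mapDomain_add, Finsupp.mapDomain_sub]

theorem hasLinearFilling_orbitGraph {M B : ℚ} (hM : 0 ≤ M)
    (s : (V × V →₀ ℚ) →ₗ[ℚ] (V × V × V →₀ ℚ))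
    (hMs : ∀ L, IsUnitFunctional K m v L → ∀ z ∈ relChains K m v, bd1 V z = 0 →
      |L z| ≤ M * l1 (s z))
    (hB : ∀ (o : MulAction.orbit H v) (p : (orbitGraph K m v).Walk o o),
      l1 (s ((walkChain p).mapDomain (Prod.map Subtype.val Subtype.val))) ≤ B * p.length) :
    ∃ C, HasLinearFilling (orbitGraph K m v) C := by
  obtain ⟨C, hC⟩ := exists_nat_ge (M * B)
  refine ⟨C, fun L hL o p => ?_⟩
  let ι : (MulAction.orbit H v × MulAction.orbit H v →₀ ℚ) →ₗ[ℚ] (V × V →₀ ℚ) :=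
    lmapDomain ℚ ℚ (Prod.map Subtype.val Subtype.val)
  have hι : LinearMap.ker ι = ⊥ := LinearMap.ker_eq_bot.2
    (Finsupp.mapDomain_injective (Subtype.val_injective.prodMap Subtype.val_injective))
  -- Any linear retraction extends `L` to chains on `V`; related triples lie in the orbit, so the
  -- unit bound persists.
  obtain ⟨κ, hκ⟩ := ι.exists_leftInverse_of_injective hι
  have hLκ : ∀ z, (L ∘ₗ κ) (ι z) = L z := fun z => by
    rw [LinearMap.comp_apply]; exact congrArg L congr($hκ z)
  have hunit : IsUnitFunctional K m v (L ∘ₗ κ) := by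
    rintro ⟨a, b, c⟩ ⟨h1, h2, h3⟩
    have h4 := hL ⟨a, h1.left_mem⟩ ⟨b, h2.left_mem⟩ ⟨c, h2.right_mem⟩
      (adjOrEq_orbitGraph_iff.2 h1) (adjOrEq_orbitGraph_iff.2 h2) (adjOrEq_orbitGraph_iff.2 h3)
    rw [← hLκ] at h4
    have h5 : ι (bd2 _ (single (⟨a, h1.left_mem⟩, ⟨b, h2.left_mem⟩, ⟨c, h2.right_mem⟩) 1)) =
        bd2 V (single (a, b, c) 1) := bd2_mapDomain_single Subtype.val _ _ _
    rwa [h5] at h4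
  have h1 := hMs _ hunit (ι (walkChain p)) (walkChain_map_mem_relChains p)
    ((bd1_mapDomain _ _).trans (by rw [bd1_walkChain_closed, Finsupp.mapDomain_zero]))
  rw [hLκ] at h1
  refine h1.trans ((mul_le_mul_of_nonneg_left (hB o p) hM).trans ?_)
  rw [← mul_assoc]
  exact mul_le_mul_of_nonneg_right hC (by positivity)

variable [TopologicalSpace H] [IsTopologicalGroup H]

/-- A functional bounded on boundaries of related triples is bounded on cycles by a multiple of the
norm of an equivariant filling. -/
theorem exists_bound_by_filling {R : Set (FreeGroup K)} (hm : 1 ≤ m) (hK : IsCompact K)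
    (hR : ∀ r ∈ R, ∃ l : List (K × Bool), l.length ≤ m ∧ FreeGroup.mk l = r)
    (hsurj : Function.Surjective (FreeGroup.lift (Subtype.val : K → H)))
    (hker : Subgroup.normalClosure R = (FreeGroup.lift (Subtype.val : K → H)).ker)
    (hv : (MulAction.stabilizer H v : Set H) ⊆ wordBall K m)
    (hc : ∀ x : V, IsCompact (MulAction.stabilizer H x : Set H))
    (ho : ∀ x : V, IsOpen (MulAction.stabilizer H x : Set H))
    (s : (V × V →₀ ℚ) →ₗ[ℚ] (V × V × V →₀ ℚ)) (hs : ∀ z, bd1 V z = 0 → bd2 V (s z) = z)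
    (hsH : ∀ (g : H) z, bd1 V z = 0 →
      s (permRep H (V × V) g z) = permRep H (V × V × V) g (s z)) :
    ∃ M : ℚ, 0 ≤ M ∧ ∀ L, IsUnitFunctional K m v L → ∀ z ∈ relChains K m v, bd1 V z = 0 →
      |L z| ≤ M * l1 (s z) := by
  obtain ⟨r, hr0, hrel, hid, hequi⟩ := exists_cycle_retraction (v := v) hm hsurj hc ho
  have hrb : ∀ f : V × V × V, r (bd2 V (single f 1)) ∈ relBoundaries K m v := fun f =>
    mem_relBoundaries hR hsurj hker hv (hrel _) (hr0 _ (bd1_bd2 _))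
  choose B hB using fun f => exists_bound_on_translates (hrb f)
  obtain ⟨T, hT, hTorb⟩ := exists_finite_relTriples (m := m) hK (hc v) (ho v)
  have hfin : (⋃ t ∈ T, ((s (bd2 V (single t 1))).support : Set (V × V × V))).Finite :=
    hT.biUnion fun t _ => Finset.finite_toSet _
  obtain ⟨M, hM⟩ := (hfin.image B).bddAbove
  -- The triples with a uniform bound. By equivariance of `s` and `r`, `F` contains the support of
  -- `s` on the boundary of every translate of the finitely many triples in `T`.
  let F : Set (V × V × V) :=
    {f | ∀ L, IsUnitFunctional K m v L → |L (r (bd2 V (single f 1)))| ≤ M}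
  have hF : ∀ z ∈ relBoundaries K m v, s z ∈ supported ℚ ℚ F := by
    intro z hz
    induction hz using Submodule.span_induction with
    | mem z hz =>
      obtain ⟨t, ht, rfl⟩ := hz
      obtain ⟨g, t', ht', rfl⟩ := hTorb t ht
      dsimp only
      rw [← permRep_single, bd2_permRep, hsH _ _ (bd1_bd2 _), mem_supported]
      intro i hi L hL
      obtain ⟨j, hj, rfl⟩ := mem_support_permRep hi
      rw [← permRep_single, bd2_permRep, hequi]
      exact (hB j L hL g).trans (hM ⟨j, Set.mem_biUnion ht' hj, rfl⟩)
    | zero => simp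
    | add x y _ _ hx hy => rw [map_add]; exact Submodule.add_mem _ hx hy
    | smul a x _ hx => rw [map_smul]; exact Submodule.smul_mem _ a hx
  refine ⟨max M 0, le_max_right _ _, fun L hL z hz hz0 => ?_⟩
  -- Push the filling of `z` in the simplex back into the related complex.
  have h1 : L z = (L ∘ₗ r ∘ₗ bd2 V) (s z) := by
    simp only [LinearMap.comp_apply]
    rw [hs z hz0, hid z hz]
  rw [h1]
  refine abs_apply_le_mul_l1 _ _ _ fun i hi => le_max_of_le_left ?_
  exact (mem_supported ℚ _).1 (hF z (mem_relBoundaries hR hsurj hker hv hz hz0)) hi L hL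

end Bound

/-! ### Geometry of Cayley–Abels graphs. -/

section CayleyAbels

variable {G : Type*} [Group G] [TopologicalSpace G] {V : Type*} [MulAction G V]
  {Γ : SimpleGraph V}

theorem finite_setOf_dist_le (hconn : Γ.Connected) (hfin : ∀ x : V, (Γ.neighborSet x).Finite)
    (x : V) (n : ℕ) : {y | Γ.dist x y ≤ n}.Finite := by
  induction n with
  | zero =>
    refine (Set.finite_singleton x).subset fun y hy => ?_
    exact ((hconn.dist_eq_zero_iff).1 (Nat.le_zero.1 hy)).symm
  | succ n ih =>
    refine (ih.union (ih.biUnion fun y _ => hfin y)).subset fun z hz => ?_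
    obtain ⟨p, hp⟩ := hconn.exists_walk_length_eq_dist x z
    rcases le_or_gt p.length n with h | h
    · exact Or.inl (hp.symm.trans_le h)
    · obtain ⟨q, r, hq, hpq⟩ := exists_walk_split p h.le
      have hr : r.length = 1 := by
        have h1 := congrArg SimpleGraph.Walk.length hpq
        have h2 : Γ.dist x z ≤ n + 1 := hz
        rw [SimpleGraph.Walk.length_append] at h1
        omega
      refine Or.inr (Set.mem_biUnion (x := p.getVert n) ?_ ?_)
      · exact (SimpleGraph.dist_le q).trans hq.le
      · exact SimpleGraph.Walk.adj_of_length_eq_one hr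

namespace IsCayleyAbelsGraph

variable (hΓ : IsCayleyAbelsGraph G Γ)
include hΓ

theorem dist_smul_le (g : G) (a b : V) : Γ.dist (g • a) (g • b) ≤ Γ.dist a b := by
  obtain ⟨p, hp⟩ := hΓ.connected.exists_walk_length_eq_dist a b
  let f : Γ →g Γ := ⟨(g • ·), fun {x y} h => (hΓ.adj_smul_iff g x y).2 h⟩
  rw [← hp, ← SimpleGraph.Walk.length_map f p]
  exact SimpleGraph.dist_le _

theorem dist_smul (g : G) (a b : V) : Γ.dist (g • a) (g • b) = Γ.dist a b :=
  le_antisymm (hΓ.dist_smul_le g a b) (by simpa using hΓ.dist_smul_le g⁻¹ (g • a) (g • b))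

/-- Up to translation a triangle of bounded size starts at a fixed vertex, so local finiteness
leaves finitely many. -/
theorem isFillingNorm (s : (V × V →₀ ℚ) →ₗ[ℚ] (V × V × V →₀ ℚ))
    (hs : ∀ (g : G) z, bd1 V z = 0 →
      s (permRep G (V × V) g z) = permRep G (V × V × V) g (s z)) :
    IsFillingNorm Γ fun z => l1 (s z) where
  zero := by simp
  add_le x y := by rw [map_add]; exact l1_add_le _ _
  neg x := by rw [map_neg, l1_neg]
  bounded D := by
    obtain ⟨o⟩ := hΓ.connected.nonempty
    have hfin := finite_setOf_dist_le hΓ.connected hΓ.locally_finite o D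
    obtain ⟨B, hB⟩ := ((hfin.prod hfin).image
      fun e => l1 (s (bd2 V (single (o, e.1, e.2) 1)))).bddAbove
    refine ⟨B, fun a b c hab hac => ?_⟩
    obtain ⟨g, rfl⟩ := hΓ.transitive o a
    have h1 : single (g • o, b, c) (1 : ℚ) =
        permRep G (V × V × V) g (single (o, g⁻¹ • b, g⁻¹ • c) 1) := by simp
    rw [h1, bd2_permRep, hs _ _ (bd1_bd2 _), l1_permRep]
    refine hB ⟨(g⁻¹ • b, g⁻¹ • c), ⟨?_, ?_⟩, rfl⟩
    · have := hΓ.dist_smul g⁻¹ (g • o) b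
      rw [inv_smul_smul] at this
      exact this.trans_le hab
    · have := hΓ.dist_smul g⁻¹ (g • o) c
      rw [inv_smul_smul] at this
      exact this.trans_le hac

end IsCayleyAbelsGraph

theorem exists_dist_le_of_wordRel {H : Subgroup G} [IsTopologicalGroup G] {K : Set H} {m : ℕ}
    {v : V} (hΓ : IsCayleyAbelsGraph G Γ) (hK : IsCompact K)
    (hc : IsCompact (MulAction.stabilizer H v : Set H))
    (ho : IsOpen (MulAction.stabilizer H v : Set H)) :
    ∃ k, ∀ a b, WordRel K m v a b → Γ.dist a b ≤ k := by
  obtain ⟨k, hk⟩ := ((finite_setOf_wordRel (m := m) hK hc ho).image (Γ.dist v)).bddAbove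
  refine ⟨k, fun a b hab => ?_⟩
  obtain ⟨g, rfl⟩ := hab.left_mem
  have h1 : Γ.dist v (g⁻¹ • b) ≤ k :=
    hk ⟨g⁻¹ • b, by simpa using hab.smul g⁻¹, rfl⟩
  rw [← hΓ.dist_smul (g : G)⁻¹]
  have h2 : (g : G)⁻¹ • g • v = v := inv_smul_smul g v
  have h3 : (g : G)⁻¹ • b = g⁻¹ • b := rfl
  dsimp only
  rwa [h2, h3]

end CayleyAbels

theorem coe_stabilizer_subgroup {G : Type*} [Group G] {V : Type*} [MulAction G V]
    (H : Subgroup G) (x : V) :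
    (MulAction.stabilizer H x : Set H) = Subtype.val ⁻¹' (MulAction.stabilizer G x : Set G) := by
  ext g
  rfl

theorem exists_resolution_of_rationalCohomologicalDimension_le {G : Type u} [Group G]
    [TopologicalSpace G] {d : ℕ} (h : rationalCohomologicalDimension G ≤ d) :
    ∃ n ≤ d, HasProjectiveResolutionOfLength G n := by
  have hne : {m : ℕ∞ | ∃ n : ℕ, m = n ∧ HasProjectiveResolutionOfLength G n}.Nonempty := by
    by_contra hempty
    rw [Set.not_nonempty_iff_eq_empty] at hempty
    rw [rationalCohomologicalDimension, hempty, sInf_empty] at h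
    exact absurd h (by simp)
  obtain ⟨n, hn, hres⟩ := csInf_mem hne
  refine ⟨n, ?_, hres⟩
  rw [rationalCohomologicalDimension, hn] at h
  exact_mod_cast h

theorem isCompactlyGenerated_of_surjective {H : Type*} [Group H] [TopologicalSpace H] {K : Set H}
    (hK : IsCompact K) (hsurj : Function.Surjective (FreeGroup.lift (Subtype.val : K → H))) :
    IsCompactlyGenerated H := by
  refine ⟨K, hK, ?_⟩
  rw [← MonoidHom.range_eq_top, FreeGroup.range_lift_eq_closure] at hsurj
  simpa using hsurj

end TDLC

theorem theorem1p1 (G : Type*) [Group G] [TopologicalSpace G] [IsTopologicalGroup G]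
    [LocallyCompactSpace G] [TotallyDisconnectedSpace G]
    (hG : TDLC.IsHyperbolic G) (hcd : TDLC.rationalCohomologicalDimension G ≤ 2)
    (H : Subgroup G) (hclosed : IsClosed (H : Set G)) (hH : TDLC.IsCompactlyPresented H) :
    TDLC.IsHyperbolic H := by
  open TDLC in
  obtain ⟨-, V, _, Γ, hΓ, hhyp⟩ := hG
  obtain ⟨n, hn, hres⟩ := exists_resolution_of_rationalCohomologicalDimension_le (d := 2) hcd
  obtain ⟨K, R, N, hK, hRN, hsurj, hker⟩ := hH
  have := hΓ.connected.nonempty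
  obtain ⟨v⟩ := hΓ.connected.nonempty
  obtain ⟨s, hs, hsG⟩ :=
    exists_equivariant_filling hΓ.isCompact_stabilizer hΓ.isOpen_stabilizer hn hres
  have hcH : ∀ x : V, IsCompact (MulAction.stabilizer H x : Set H) := fun x => by
    rw [coe_stabilizer_subgroup]
    exact hclosed.isClosedEmbedding_subtypeVal.isCompact_preimage (hΓ.isCompact_stabilizer x)
  have hoH : ∀ x : V, IsOpen (MulAction.stabilizer H x : Set H) := fun x => by
    rw [coe_stabilizer_subgroup]
    exact (hΓ.isOpen_stabilizer x).preimage continuous_subtype_val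
  have : LocallyCompactSpace H := hclosed.isClosedEmbedding_subtypeVal.locallyCompactSpace
  obtain ⟨m₀, hm₀⟩ := exists_subset_wordBall hK hsurj (hcH v)
  -- Room for the letters, the relators and the stabilizer of `v`.
  set m := max 1 (max N m₀) with hm_def
  have hm : 1 ≤ m := le_max_left _ _
  have hv : (MulAction.stabilizer H v : Set H) ⊆ wordBall K m :=
    hm₀.trans (wordBall_mono ((le_max_right _ _).trans (le_max_right _ _)))
  have hR : ∀ r ∈ R, ∃ l : List (K × Bool), l.length ≤ m ∧ FreeGroup.mk l = r := by
    classical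
    intro r hr
    refine ⟨r.toWord, ?_, FreeGroup.mk_toWord⟩
    have h1 : r.toWord.length ≤ N := by
      convert hRN r hr
      exact (congrArg (fun inst => (@FreeGroup.norm K inst r)) (Subsingleton.elim _ _))
    exact h1.trans ((le_max_left _ _).trans (le_max_right _ _))
  obtain ⟨M, hM, hMs⟩ := exists_bound_by_filling hm hK hR hsurj hker hv hcH hoH s hs
    fun g z hz => hsG g z hz
  obtain ⟨k, hk⟩ := exists_dist_le_of_wordRel (m := m) hΓ hK (hcH v) (hoH v)
  obtain ⟨B, -, hB⟩ := (hΓ.isFillingNorm s hsG).exists_linear_bound_map hhyp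
    (Δ := orbitGraph K m v) Subtype.val (fun a b hab => hk a b hab.2)
  obtain ⟨C, hC⟩ := hasLinearFilling_orbitGraph hM s hMs hB
  exact ⟨isCompactlyGenerated_of_surjective hK hsurj, MulAction.orbit H v, inferInstance,
    orbitGraph K m v, isCayleyAbelsGraph_orbitGraph hm hK hsurj hcH hoH,
    hC.isHyperbolicGraph (connected_orbitGraph hm hsurj)⟩
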